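/- Let $\mathcal H$ be a real Hilbert space and let $D\subseteq\mathcal H$ be closed and convex. Let $\Phi_t$ ($t>0$) and $\Phi$ be proper, convex, lower semicontinuous functions $\mathcal H\to\mathbb R\cup\{+\infty\}$ with $\overline{\operatorname{dom}\Phi_t}\subseteq D$ for all $t>0$ and $\overline{\operatorname{dom}\Phi}\subseteq D$. Let $B_t$ ($t>0$) and $B$ be $\beta$-cocoercive operators $D\to\mathcal H$, that is, $\langle Bu-Bv,u-v\rangle\ge\beta\|Bu-Bv\|^2$ for all $u,v\in D$, and likewise for each $B_t$. Let $y,x_0\in D$ and $\mu\in(0,2\beta)$, and write $\operatorname{prox}_{\mu\Phi}(z)=\operatorname{argmin}_{q\in\mathcal H}\{\Phi(q)+\frac1{2\mu}\|q-z\|^2\}$. Assume the following. (i) $\varepsilon:[0,\infty)\to(0,\infty)$ is (locally) absolutely continuous and nonincreasing, with $\lim_{t\to\infty}\varepsilon(t)=0$ and $\int_0^\infty\varepsilon(s)\,ds=+\infty$, and $\dot\varepsilon(t)/\varepsilon(t)^2\to0$ as $t\to\infty$, where this last limit is taken in the essential sense (off a Lebesgue-null set of times). (ii) There are constants $c,p>0$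 and a function $\kappa\ge0$ with $\|\operatorname{prox}_{\mu\Phi_t}(z)-\operatorname{prox}_{\mu\Phi}(z)\|\le\kappa(t)(\|z\|+c)^p$ for all $t>0$ and $z\in\mathcal H$, and $\lim_{t\to\infty}\kappa(t)/\varepsilon(t)=0$. (iii) For every compact $K\subseteq D$, $\lim_{t\to\infty}\frac1{\varepsilon(t)}\sup_{u\in K}\|B_t u-Bu\|=0$. Consider the system $$-\dot x(t)=x(t)-\operatorname{prox}_{\mu\Phi_t}\bigl(x(t)-\mu B_t x(t)\bigr)+\varepsilon(t)(x(t)-y)\quad\text{for a.e. }t\ge0,\qquad x(0)=x_0,$$ whose solutions are understood as locally absolutely continuous functions $x:[0,\infty)\to\mathcal H$ with values in $D$. Then: (a) the system has at most one solution; (b) if for every $z\in D$ the map $t\mapsto\operatorname{prox}_{\mu\Phi_t}(z-\mu B_t z)$ is locally integrable on $[0,\infty)$, then the system has a solution; (c) if $\operatorname{zer}(\partial\Phi+B)=\{z\in D: 0\in\partial\Phi(z)+Bz\}$ is nonempty, then $y$ has exactly one nearest point $\operatorname{proj}_{\operatorname{zer}(\partial\Phi+B)}(y)$ in this set, and the solution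 $x(t)$ of the system, whenever it exists, converges strongly to it as $t\to+\infty$. -/

import Mathlib

open Set Filter Topology MeasureTheory

/-- The operator `B` is `β`-cocoercive on the set `D`. -/
def CocoerciveOn {H : Type*} [NormedAddCommGroup H] [InnerProductSpace ℝ H]
    (β : ℝ) (B : H → H) (D : Set H) : Prop :=
  ∀ x ∈ D, ∀ y ∈ D, β * ‖B x - B y‖ ^ 2 ≤ inner ℝ (B x - B y) (x - y)

/-- A function `f : H → ℝ ∪ {+∞}` (an extended-real-valued function that never takes the value
`-∞`) which is proper, convex (its epigraph is convex) and lower semicontinuous. -/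
structure ProperConvexLsc {H : Type*} [NormedAddCommGroup H] [InnerProductSpace ℝ H]
    (f : H → EReal) : Prop where
  ne_bot : ∀ x, f x ≠ ⊥
  exists_ne_top : ∃ x, f x ≠ ⊤
  convex_epigraph : Convex ℝ {q : H × ℝ | f q.1 ≤ (q.2 : EReal)}
  lsc : LowerSemicontinuous f

/-- The effective domain of an extended-real-valued function. -/
def effDom {H : Type*} (f : H → EReal) : Set H := {x | f x < ⊤}

/-- The point `p` minimizes `q ↦ f q + ‖q - x‖ ^ 2 / (2 * μ)` over the whole space. -/
def IsProx {H : Type*} [NormedAddCommGroup H] (μ : ℝ) (f : H → EReal) (x p : H) : Prop :=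
  ∀ q : H, f p + ((1 / (2 * μ) * ‖p - x‖ ^ 2 : ℝ) : EReal) ≤
    f q + ((1 / (2 * μ) * ‖q - x‖ ^ 2 : ℝ) : EReal)

/-- The proximal point operator `prox_{μ f}`: the minimizer of
`q ↦ f q + ‖q - x‖ ^ 2 / (2 * μ)`, which exists and is unique when `μ > 0` and `f` is proper,
convex and lower semicontinuous on a Hilbert space. -/
noncomputable def prox {H : Type*} [NormedAddCommGroup H] (μ : ℝ) (f : H → EReal) (x : H) : H :=
  Classical.epsilon (IsProx μ f x)

/-- The convex subdifferential of `f` at `x`. For a proper `f` it is empty outside of the effective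
domain, because then the inequality fails at any point where `f` is finite. -/
def subdiff {H : Type*} [NormedAddCommGroup H] [InnerProductSpace ℝ H]
    (f : H → EReal) (x : H) : Set H :=
  {u | ∀ w : H, f x + ((inner ℝ u (w - x) : ℝ) : EReal) ≤ f w}

/-- The set of zeros of `∂f + B`, where `B` is an operator with domain `D`. -/
def zerSum {H : Type*} [NormedAddCommGroup H] [InnerProductSpace ℝ H]
    (D : Set H) (f : H → EReal) (B : H → H) : Set H :=
  {z | z ∈ D ∧ ∃ u ∈ subdiff f z, u + B z = 0}

/-- The set of projections (nearest points) of `y` onto `S`. -/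
def projSet {H : Type*} [NormedAddCommGroup H] (S : Set H) (y : H) : Set H :=
  {p | p ∈ S ∧ ‖y - p‖ = Metric.infDist y S}

/-- Local absolute continuity on the half-line `[0, ∞)`. -/
def LocallyAC {E : Type*} [NormedAddCommGroup E] (x : ℝ → E) : Prop :=
  ∀ T : ℝ, 0 < T → AbsolutelyContinuousOnInterval x 0 T

/-- `x` is a (strong) solution on `[0, ∞)` of the regularized forward-backward system
`-x'(t) = x(t) - prox_{μ Φ_t} (x(t) - μ B_t x(t)) + ε(t) (x(t) - y)` for almost every `t ≥ 0`,
with `x(0) = x₀`. The trajectory stays in `D`, the common domain of the operators `B_t`. -/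
structure IsTrajectory {H : Type*} [NormedAddCommGroup H] [InnerProductSpace ℝ H]
    (D : Set H) (Φ : ℝ → H → EReal) (B : ℝ → H → H) (μ : ℝ) (ε : ℝ → ℝ) (y x₀ : H)
    (x : ℝ → H) : Prop where
  locallyAC : LocallyAC x
  mem : ∀ t : ℝ, 0 ≤ t → x t ∈ D
  init : x 0 = x₀
  ode : ∀ᵐ t ∂(volume.restrict (Ici (0 : ℝ))),
    HasDerivAt x (-(x t - prox μ (Φ t) (x t - μ • B t (x t)) + ε t • (x t - y))) t

/-! Put T_t = prox_{μΦ_t} ∘ (id - μB_t), and T likewise for Φ and B. Since μ < 2β, these are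
nonexpansive self-maps of D, and the zeros of ∂Φ + B are the fixed points of T. The system reads x'
= T_t x - x - ε(x - y).

Convergence compares x with the Tikhonov path: w(e) is the solution of (1 + e)w = Tw + ey. As e ↓ 0
it converges to the fixed point q of T nearest to y, and ‖w(e) - w(d)‖ ≤ (R/d)|e - d|
(`exists_tikhonov_path`). For u(t) = ‖x(t) - w(ε(t))‖, nonexpansiveness of T_t gives almost
everywhere u' ≤ -εu + ‖T_t w(ε) - T w(ε)‖ + R|ε'|/ε. The last term is o(ε) by (i). The middle one is
o(ε) by (ii) and (iii), because the path together with q is compact (`isCompact_range_tikhonov`). So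
eventually u' ≤ ε(δ - u) for every δ > 0, and ∫ε = ∞ forces u → 0 (`tendsto_zero_of_ae_deriv_le`).

Uniqueness is the same differential inequality for the distance of two solutions. Existence is
Picard iteration on the variation of constants formula (`exists_eqOn_picard`); its right-hand side
is a weighted average of points of D, which keeps the iterates in D. -/

section Prox

variable {H : Type*} [NormedAddCommGroup H] [InnerProductSpace ℝ H]

/-! ### Proximal points and the forward-backward operator. -/

namespace ProperConvexLsc

variable {f : H → EReal}

lemma isClosed_epigraph (hf : ProperConvexLsc f) :
    IsClosed {q : H × ℝ | f q.1 ≤ (q.2 : EReal)} :=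
  hf.lsc.isClosed_epigraph.preimage
    (continuous_fst.prodMk (continuous_coe_real_ereal.comp continuous_snd))

/-- Lower semicontinuity gives f > a - 1 on a ball of radius δ about x₀. For q farther away,
convexity along the segment from x₀ to q, at its point at distance δ/2, bounds f q below with slope
2/δ. -/
lemma exists_affine_lower_bound (hf : ProperConvexLsc f) :
    ∃ (x₀ : H) (a L : ℝ), 0 ≤ L ∧ ∀ (q : H) (r : ℝ), f q ≤ r → a - L * ‖q - x₀‖ ≤ r := by
  obtain ⟨x₀, hx₀⟩ := hf.exists_ne_top
  obtain ⟨a, ha⟩ : ∃ a : ℝ, f x₀ = a := ⟨_, (EReal.coe_toReal hx₀ (hf.ne_bot x₀)).symm⟩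
  have hlsc : ∀ᶠ q in 𝓝 x₀, ((a - 1 : ℝ) : EReal) < f q := by
    apply hf.lsc x₀
    rw [ha]
    exact_mod_cast sub_one_lt a
  obtain ⟨δ, hδ, hball⟩ := Metric.eventually_nhds_iff.mp hlsc
  refine ⟨x₀, a - 1, 2 / δ, by positivity, fun q r hq => ?_⟩
  by_cases hqd : ‖q - x₀‖ ≤ δ / 2
  · have h1 : a - 1 < r := by
      have := (hball (y := q) (by rw [dist_eq_norm]; linarith)).trans_le hq
      exact_mod_cast this
    have : 0 ≤ 2 / δ * ‖q - x₀‖ := by positivity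
    linarith
  · push Not at hqd
    have hn : 0 < ‖q - x₀‖ := by linarith
    set s : ℝ := δ / 2 / ‖q - x₀‖ with hs
    have hs0 : 0 < s := by positivity
    have hs1 : s ≤ 1 := by rw [hs, div_le_one hn]; exact hqd.le
    have hmem := hf.convex_epigraph (x := (x₀, a)) (by simp [ha]) (y := (q, r)) hq
      (sub_nonneg.mpr hs1) hs0.le (by ring)
    have hle : f ((1 - s) • x₀ + s • q) ≤ (((1 - s) * a + s * r : ℝ) : EReal) := hmem
    have hgt : a - 1 < (1 - s) * a + s * r := by
      have hd : dist ((1 - s) • x₀ + s • q) x₀ < δ := by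
        rw [dist_eq_norm, show (1 - s) • x₀ + s • q - x₀ = s • (q - x₀) by module, norm_smul,
          Real.norm_of_nonneg hs0.le, hs, div_mul_cancel₀ _ hn.ne']
        linarith
      exact_mod_cast (hball hd).trans_le hle
    have h2 : s * (2 / δ * ‖q - x₀‖) = 1 := by rw [hs]; field_simp
    have h3 : s * (a - 2 / δ * ‖q - x₀‖) < s * r := by linarith
    linarith [lt_of_mul_lt_mul_left h3 hs0.le]

/-- The direct method, run on the epigraph so that the objective is real-valued. The parallelogram
law makes minimizing sequences Cauchy, and closedness of the epigraph keeps the limit admissible. -/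
lemma exists_isProx [CompleteSpace H] (hf : ProperConvexLsc f) {μ : ℝ} (hμ : 0 < μ) (x : H) :
    ∃ p, IsProx μ f x p := by
  set k : ℝ := 1 / (2 * μ) with hk
  have hk0 : 0 < k := by positivity
  obtain ⟨x₀, a, L, hL, hbound⟩ := hf.exists_affine_lower_bound
  set C : Set (H × ℝ) := {q : H × ℝ | f q.1 ≤ (q.2 : EReal)} with hC
  set F : H × ℝ → ℝ := fun q => q.2 + k * ‖q.1 - x‖ ^ 2 with hF
  have hbdd : BddBelow (F '' C) := by
    -- L²/(4k) is the maximum of Ls - ks² over s.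
    refine ⟨a - L * ‖x - x₀‖ - L ^ 2 / (4 * k), ?_⟩
    rintro _ ⟨⟨q, r⟩, hq, rfl⟩
    have h1 := hbound q r hq
    have h2 : L * ‖q - x₀‖ ≤ L * (‖q - x‖ + ‖x - x₀‖) :=
      mul_le_mul_of_nonneg_left (norm_sub_le_norm_sub_add_norm_sub q x x₀) hL
    have h3 : L * ‖q - x‖ - k * ‖q - x‖ ^ 2 ≤ L ^ 2 / (4 * k) := by
      rw [le_div_iff₀ (by positivity)]
      nlinarith [sq_nonneg (L - 2 * k * ‖q - x‖)]
    simp only [hF]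
    linarith
  have hne : (F '' C).Nonempty := by
    obtain ⟨z, hz⟩ := hf.exists_ne_top
    exact ⟨_, (z, (f z).toReal), EReal.le_coe_toReal hz, rfl⟩
  set m := sInf (F '' C) with hm
  have hmle : ∀ q ∈ C, m ≤ F q := fun q hq => csInf_le hbdd ⟨q, hq, rfl⟩
  have hseq : ∀ n : ℕ, ∃ q ∈ C, F q < m + 1 / ((n : ℝ) + 1) := fun n => by
    obtain ⟨_, ⟨q, hq, rfl⟩, hlt⟩ := exists_lt_of_csInf_lt hne
      (show sInf (F '' C) < m + 1 / ((n : ℝ) + 1) from lt_add_of_pos_right _ (by positivity))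
    exact ⟨q, hq, hlt⟩
  choose q hqC hqF using hseq
  have hmid : ∀ u ∈ C, ∀ v ∈ C, k / 4 * ‖u.1 - v.1‖ ^ 2 ≤ (F u + F v) / 2 - m := by
    intro u hu v hv
    have h1 := hmle _ (hf.convex_epigraph hu hv (by norm_num : (0 : ℝ) ≤ 1 / 2)
      (by norm_num : (0 : ℝ) ≤ 1 / 2) (by norm_num))
    have h2 := parallelogram_law_with_norm ℝ (u.1 - x) (v.1 - x)
    have h3 : ‖(1 / 2 : ℝ) • u.1 + (1 / 2 : ℝ) • v.1 - x‖ = 1 / 2 * ‖u.1 - x + (v.1 - x)‖ := by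
      rw [show (1 / 2 : ℝ) • u.1 + (1 / 2 : ℝ) • v.1 - x
        = (1 / 2 : ℝ) • (u.1 - x + (v.1 - x)) by module, norm_smul]
      norm_num
    simp only [hF, Prod.fst_add, Prod.snd_add, Prod.smul_fst, Prod.smul_snd, smul_eq_mul, h3,
      sub_sub_sub_cancel_right] at h1 h2 ⊢
    nlinarith
  have hcau : CauchySeq fun n => (q n).1 := by
    refine cauchySeq_of_le_tendsto_0 (fun n : ℕ => √(4 / k * (1 / ((n : ℝ) + 1)))) ?_ ?_
    · intro i j N hi hj
      rw [dist_eq_norm]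
      apply Real.le_sqrt_of_sq_le
      have h1 := hmid _ (hqC i) _ (hqC j)
      have h2 : 1 / ((i : ℝ) + 1) ≤ 1 / ((N : ℝ) + 1) := by gcongr
      have h3 : 1 / ((j : ℝ) + 1) ≤ 1 / ((N : ℝ) + 1) := by gcongr
      have h4 : k / 4 * ‖(q i).1 - (q j).1‖ ^ 2 ≤ 1 / ((N : ℝ) + 1) := by
        linarith [hqF i, hqF j]
      calc ‖(q i).1 - (q j).1‖ ^ 2 = 4 / k * (k / 4 * ‖(q i).1 - (q j).1‖ ^ 2) := by field_simp
        _ ≤ _ := by gcongr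
    · have h := (tendsto_one_div_add_atTop_nhds_zero_nat (𝕜 := ℝ)).const_mul (4 / k)
      simpa using h.sqrt
  obtain ⟨p, hp⟩ := cauchySeq_tendsto_of_complete hcau
  have hFlim : Tendsto (fun n => F (q n)) atTop (𝓝 m) := by
    refine tendsto_of_tendsto_of_tendsto_of_le_of_le tendsto_const_nhds ?_
      (fun n => hmle _ (hqC n)) (fun n => (hqF n).le)
    simpa using (tendsto_one_div_add_atTop_nhds_zero_nat (𝕜 := ℝ)).const_add m
  have hquad : Tendsto (fun n => k * ‖(q n).1 - x‖ ^ 2) atTop (𝓝 (k * ‖p - x‖ ^ 2)) :=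
    ((hp.sub_const x).norm.pow 2).const_mul k
  have hrlim : Tendsto (fun n => (q n).2) atTop (𝓝 (m - k * ‖p - x‖ ^ 2)) := by
    refine (hFlim.sub hquad).congr fun n => ?_
    simp [hF]
  have hpC : (p, m - k * ‖p - x‖ ^ 2) ∈ C :=
    hf.isClosed_epigraph.mem_of_tendsto (hp.prodMk_nhds hrlim) (Eventually.of_forall hqC)
  refine ⟨p, fun z => ?_⟩
  have hpm : f p + ((k * ‖p - x‖ ^ 2 : ℝ) : EReal) ≤ (m : EReal) := by
    refine (add_le_add_left (show f p ≤ _ from hpC) _).trans_eq ?_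
    rw [← EReal.coe_add, sub_add_cancel]
  by_cases hz : f z = ⊤
  · rw [hz, EReal.top_add_coe]
    exact le_top
  · rw [← EReal.coe_toReal hz (hf.ne_bot z), ← EReal.coe_add]
    refine hpm.trans (EReal.coe_le_coe_iff.mpr ?_)
    exact hmle (z, (f z).toReal) (EReal.le_coe_toReal hz)

lemma ne_top_of_mem_subdiff (hf : ProperConvexLsc f) {p u : H} (hu : u ∈ subdiff f p) :
    f p ≠ ⊤ := by
  intro htop
  obtain ⟨z, hz⟩ := hf.exists_ne_top
  have := hu z
  rw [htop, EReal.top_add_coe] at this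
  exact hz (top_le_iff.mp this)

/-- Fermat's rule: compare p with p + s(w - p), divide by s and let s ↓ 0. The converse is the
expansion at s = 1, whose quadratic remainder is nonnegative. -/
lemma isProx_iff_mem_subdiff (hf : ProperConvexLsc f) {μ : ℝ} (hμ : 0 < μ) {x p : H} :
    IsProx μ f x p ↔ (1 / μ) • (x - p) ∈ subdiff f p := by
  have hexp : ∀ (s : ℝ) (w : H), 1 / (2 * μ) * ‖p + s • (w - p) - x‖ ^ 2 =
      1 / (2 * μ) * ‖p - x‖ ^ 2 - s * inner ℝ ((1 / μ) • (x - p)) (w - p)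
        + s ^ 2 * (1 / (2 * μ) * ‖w - p‖ ^ 2) := by
    intro s w
    rw [show p + s • (w - p) - x = (p - x) + s • (w - p) by abel, norm_add_sq_real, norm_smul,
      inner_smul_right, inner_smul_left, ← neg_sub p x, inner_neg_left, mul_pow,
      Real.norm_eq_abs, sq_abs]
    simp only [conj_trivial]
    field_simp
    ring
  constructor
  · intro hp
    have hpt : f p ≠ ⊤ := by
      intro htop
      obtain ⟨z, hz⟩ := hf.exists_ne_top
      have := hp z
      rw [htop, EReal.top_add_coe, ← EReal.coe_toReal hz (hf.ne_bot z), ← EReal.coe_add] at this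
      exact EReal.coe_ne_top _ (top_le_iff.mp this)
    intro w
    by_cases hw : f w = ⊤
    · rw [hw]; exact le_top
    have hfp := EReal.coe_toReal hpt (hf.ne_bot p)
    have hfw := EReal.coe_toReal hw (hf.ne_bot w)
    set a := (f p).toReal
    set b := (f w).toReal
    rw [← hfp, ← hfw, ← EReal.coe_add, EReal.coe_le_coe_iff]
    set i : ℝ := inner ℝ ((1 / μ) • (x - p)) (w - p)
    have key : ∀ s ∈ Ioo (0 : ℝ) 1, a + i - s * (1 / (2 * μ) * ‖w - p‖ ^ 2) ≤ b := by
      intro s hs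
      have hmem := hf.convex_epigraph (x := (p, a)) hfp.ge (y := (w, b)) hfw.ge
        (sub_nonneg.mpr hs.2.le) hs.1.le (by ring)
      have hle : f ((1 - s) • p + s • w) ≤ (((1 - s) * a + s * b : ℝ) : EReal) := hmem
      rw [show (1 - s) • p + s • w = p + s • (w - p) by module] at hle
      have h1 := (hp (p + s • (w - p))).trans (add_le_add_left hle _)
      rw [← hfp, ← EReal.coe_add, ← EReal.coe_add, EReal.coe_le_coe_iff, hexp s w] at h1
      have h2 : s * (a + i - s * (1 / (2 * μ) * ‖w - p‖ ^ 2)) ≤ s * b := by linarith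
      exact le_of_mul_le_mul_left h2 hs.1
    have hlim : Tendsto (fun s : ℝ => a + i - s * (1 / (2 * μ) * ‖w - p‖ ^ 2)) (𝓝[>] 0)
        (𝓝 (a + i)) := by
      have : Continuous fun s : ℝ => a + i - s * (1 / (2 * μ) * ‖w - p‖ ^ 2) := by fun_prop
      simpa using (this.tendsto 0).mono_left nhdsWithin_le_nhds
    exact le_of_tendsto hlim (mem_of_superset (Ioo_mem_nhdsGT one_pos) key)
  · intro hu w
    have hfp := EReal.coe_toReal (hf.ne_top_of_mem_subdiff hu) (hf.ne_bot p)
    by_cases hw : f w = ⊤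
    · rw [hw, EReal.top_add_coe]; exact le_top
    have hfw := EReal.coe_toReal hw (hf.ne_bot w)
    have h1 := hu w
    have h2 := hexp 1 w
    rw [← hfp, ← hfw, ← EReal.coe_add, EReal.coe_le_coe_iff] at h1
    rw [← hfp, ← hfw, ← EReal.coe_add, ← EReal.coe_add, EReal.coe_le_coe_iff]
    rw [one_smul, add_sub_cancel] at h2
    have : 0 ≤ 1 / (2 * μ) * ‖w - p‖ ^ 2 := by positivity
    linarith

lemma inner_nonneg_of_mem_subdiff (hf : ProperConvexLsc f) {p q u v : H}
    (hu : u ∈ subdiff f p) (hv : v ∈ subdiff f q) : 0 ≤ inner ℝ (u - v) (p - q) := by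
  have h1 := hu q
  have h2 := hv p
  rw [← EReal.coe_toReal (hf.ne_top_of_mem_subdiff hu) (hf.ne_bot p),
    ← EReal.coe_toReal (hf.ne_top_of_mem_subdiff hv) (hf.ne_bot q), ← EReal.coe_add,
    EReal.coe_le_coe_iff] at h1 h2
  rw [← neg_sub p q, inner_neg_right] at h1
  rw [inner_sub_left]
  linarith

/-- Monotonicity of the subdifferential gives ‖p - p'‖² ≤ ⟨x - x', p - p'⟩. The case x = x' is
uniqueness of the minimizer. -/
lemma norm_sub_le_of_isProx (hf : ProperConvexLsc f) {μ : ℝ} (hμ : 0 < μ) {x x' p p' : H}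
    (hp : IsProx μ f x p) (hp' : IsProx μ f x' p') : ‖p - p'‖ ≤ ‖x - x'‖ := by
  have h := hf.inner_nonneg_of_mem_subdiff ((hf.isProx_iff_mem_subdiff hμ).mp hp)
    ((hf.isProx_iff_mem_subdiff hμ).mp hp')
  rw [← smul_sub, inner_smul_left, show x - p - (x' - p') = (x - x') - (p - p') by abel,
    inner_sub_left, real_inner_self_eq_norm_sq] at h
  have h2 : 0 ≤ inner ℝ (x - x') (p - p') - ‖p - p'‖ ^ 2 :=
    nonneg_of_mul_nonneg_right h (by simpa using hμ)
  have h3 := real_inner_le_norm (x - x') (p - p')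
  by_contra! hlt
  nlinarith [norm_nonneg (x - x')]

variable [CompleteSpace H]

lemma isProx_prox (hf : ProperConvexLsc f) {μ : ℝ} (hμ : 0 < μ) (x : H) :
    IsProx μ f x (prox μ f x) :=
  Classical.epsilon_spec (hf.exists_isProx hμ x)

lemma norm_prox_sub_prox_le (hf : ProperConvexLsc f) {μ : ℝ} (hμ : 0 < μ) (x x' : H) :
    ‖prox μ f x - prox μ f x'‖ ≤ ‖x - x'‖ :=
  hf.norm_sub_le_of_isProx hμ (hf.isProx_prox hμ x) (hf.isProx_prox hμ x')

lemma prox_mem_effDom (hf : ProperConvexLsc f) {μ : ℝ} (hμ : 0 < μ) (x : H) :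
    prox μ f x ∈ effDom f :=
  lt_top_iff_ne_top.mpr <| hf.ne_top_of_mem_subdiff <|
    (hf.isProx_iff_mem_subdiff hμ).mp (hf.isProx_prox hμ x)

lemma prox_eq_iff (hf : ProperConvexLsc f) {μ : ℝ} (hμ : 0 < μ) {x p : H} :
    prox μ f x = p ↔ (1 / μ) • (x - p) ∈ subdiff f p := by
  rw [← hf.isProx_iff_mem_subdiff hμ]
  refine ⟨fun h => h ▸ hf.isProx_prox hμ x, fun h => ?_⟩
  have := hf.norm_sub_le_of_isProx hμ (hf.isProx_prox hμ x) h
  rwa [sub_self, norm_zero, norm_le_zero_iff, sub_eq_zero] at this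

end ProperConvexLsc

/-- The forward-backward operator `prox_{μ f} ∘ (id - μ B)`. -/
noncomputable def forwardBackward (μ : ℝ) (f : H → EReal) (B : H → H) (z : H) : H :=
  prox μ f (z - μ • B z)

/-- Expanding the square, cocoercivity leaves ‖u - v‖² - μ(2β - μ)‖Bu - Bv‖² as an upper bound. -/
lemma CocoerciveOn.norm_forward_sub_le {β μ : ℝ} {B : H → H} {D : Set H}
    (hB : CocoerciveOn β B D) (hμ : μ ∈ Ioo 0 (2 * β)) {u v : H} (hu : u ∈ D) (hv : v ∈ D) :
    ‖(u - μ • B u) - (v - μ • B v)‖ ≤ ‖u - v‖ := by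
  have h := hB u hu v hv
  have hsq : ‖(u - μ • B u) - (v - μ • B v)‖ ^ 2 ≤ ‖u - v‖ ^ 2 := by
    rw [show (u - μ • B u) - (v - μ • B v) = (u - v) - μ • (B u - B v) by module,
      norm_sub_sq_real, inner_smul_right, norm_smul, mul_pow, Real.norm_eq_abs, sq_abs,
      real_inner_comm]
    have h1 : μ * (β * ‖B u - B v‖ ^ 2) ≤ μ * inner ℝ (B u - B v) (u - v) :=
      mul_le_mul_of_nonneg_left h hμ.1.le
    have h2 : 0 ≤ μ * (2 * β - μ) * ‖B u - B v‖ ^ 2 :=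
      mul_nonneg (mul_nonneg hμ.1.le (sub_nonneg.mpr hμ.2.le)) (sq_nonneg _)
    nlinarith
  exact (pow_le_pow_iff_left₀ (norm_nonneg _) (norm_nonneg _) two_ne_zero).mp hsq

lemma CocoerciveOn.norm_sub_le {β : ℝ} (hβ : 0 < β) {B : H → H} {D : Set H}
    (hB : CocoerciveOn β B D) {u v : H} (hu : u ∈ D) (hv : v ∈ D) :
    ‖B u - B v‖ ≤ 1 / β * ‖u - v‖ := by
  have h := (hB u hu v hv).trans (real_inner_le_norm _ _)
  rw [one_div, inv_mul_eq_div, le_div_iff₀ hβ]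
  by_contra! hlt
  nlinarith [norm_nonneg (B u - B v), norm_nonneg (u - v), mul_nonneg (norm_nonneg (B u - B v)) hβ.le]

lemma CocoerciveOn.continuousOn {β : ℝ} (hβ : 0 < β) {B : H → H} {D : Set H}
    (hB : CocoerciveOn β B D) : ContinuousOn B D := by
  refine (LipschitzOnWith.of_dist_le_mul (K := (1 / β).toNNReal) fun u hu v hv => ?_).continuousOn
  rw [dist_eq_norm, dist_eq_norm, Real.coe_toNNReal _ (by positivity)]
  exact hB.norm_sub_le hβ hu hv

variable [CompleteSpace H]

lemma norm_forwardBackward_sub_le {β μ : ℝ} {f : H → EReal} {B : H → H} {D : Set H}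
    (hf : ProperConvexLsc f) (hB : CocoerciveOn β B D) (hμ : μ ∈ Ioo 0 (2 * β)) {u v : H}
    (hu : u ∈ D) (hv : v ∈ D) :
    ‖forwardBackward μ f B u - forwardBackward μ f B v‖ ≤ ‖u - v‖ :=
  (hf.norm_prox_sub_prox_le hμ.1 _ _).trans (hB.norm_forward_sub_le hμ hu hv)

lemma forwardBackward_mem {μ : ℝ} {f : H → EReal} {B : H → H} {D : Set H}
    (hf : ProperConvexLsc f) (hdom : closure (effDom f) ⊆ D) (hμ : 0 < μ) (z : H) :
    forwardBackward μ f B z ∈ D :=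
  hdom (subset_closure (hf.prox_mem_effDom hμ _))

lemma zerSum_eq_fixedPoints {μ : ℝ} {f : H → EReal} {B : H → H} {D : Set H}
    (hf : ProperConvexLsc f) (hμ : 0 < μ) :
    zerSum D f B = {z | z ∈ D ∧ forwardBackward μ f B z = z} := by
  ext z
  have h : (1 / μ) • (z - μ • B z - z) = -B z := by
    rw [sub_sub_cancel_left, smul_neg, smul_smul, one_div_mul_cancel hμ.ne', one_smul]
  simp only [zerSum, forwardBackward, mem_ofPred_eq, hf.prox_eq_iff hμ, h]
  refine and_congr_right fun _ => ⟨?_, fun h => ⟨_, h, neg_add_cancel _⟩⟩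
  rintro ⟨u, hu, huB⟩
  rwa [← eq_neg_of_add_eq_zero_left huB]

end Prox

/-! ### Tikhonov path of a nonexpansive map. -/

section Tikhonov

variable {H : Type*} [NormedAddCommGroup H] [InnerProductSpace ℝ H]

/-- The variational inequality yields ‖y - q‖² + ‖q - p‖² ≤ ‖y - p‖², hence both minimality and
uniqueness. -/
lemma projSet_eq_singleton {S : Set H} {y q : H} (hq : q ∈ S)
    (h : ∀ p ∈ S, inner ℝ (q - y) (q - p) ≤ 0) : projSet S y = {q} := by
  have hsq : ∀ p ∈ S, ‖y - q‖ ^ 2 + ‖q - p‖ ^ 2 ≤ ‖y - p‖ ^ 2 := by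
    intro p hp
    have h1 := norm_add_sq_real (y - q) (q - p)
    rw [sub_add_sub_cancel, ← neg_sub q y, inner_neg_left] at h1
    rw [← neg_sub q y]
    linarith [h p hp]
  have hdist : Metric.infDist y S = ‖y - q‖ := by
    refine le_antisymm ((Metric.infDist_le_dist_of_mem hq).trans_eq (dist_eq_norm _ _)) ?_
    refine (Metric.le_infDist ⟨q, hq⟩).mpr fun p hp => ?_
    rw [dist_eq_norm]
    refine (pow_le_pow_iff_left₀ (norm_nonneg _) (norm_nonneg _) two_ne_zero).mp ?_
    linarith [hsq p hp, sq_nonneg ‖q - p‖]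
  refine Subset.antisymm ?_ (singleton_subset_iff.mpr ⟨hq, hdist.symm⟩)
  rintro p ⟨hp, hpd⟩
  have h1 := hsq p hp
  rw [hpd, hdist] at h1
  have h2 : ‖q - p‖ = 0 := pow_eq_zero_iff two_ne_zero |>.mp
    (le_antisymm (by linarith) (sq_nonneg _))
  exact (sub_eq_zero.mp (norm_eq_zero.mp h2)).symm

lemma inner_id_sub_nonneg {D : Set H} {T : H → H}
    (hT : ∀ u ∈ D, ∀ v ∈ D, ‖T u - T v‖ ≤ ‖u - v‖) {u v : H} (hu : u ∈ D) (hv : v ∈ D) :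
    0 ≤ inner ℝ ((u - T u) - (v - T v)) (u - v) := by
  rw [show (u - T u) - (v - T v) = (u - v) - (T u - T v) by abel, inner_sub_left,
    real_inner_self_eq_norm_sq]
  have h1 := real_inner_le_norm (T u - T v) (u - v)
  have h2 := mul_le_mul_of_nonneg_right (hT u hu v hv) (norm_nonneg (u - v))
  nlinarith

/-- Banach's theorem for w ↦ (Tw + ey)/(1 + e): a convex combination, so it preserves D, and a
contraction with constant 1/(1 + e). -/
lemma exists_tikhonov_point [CompleteSpace H] {D : Set H} (hD : IsClosed D) (hDc : Convex ℝ D)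
    {T : H → H} (hTD : ∀ u ∈ D, T u ∈ D) (hT : ∀ u ∈ D, ∀ v ∈ D, ‖T u - T v‖ ≤ ‖u - v‖)
    {y : H} (hy : y ∈ D) {e : ℝ} (he : 0 < e) :
    ∃ w ∈ D, (1 + e) • w = T w + e • y := by
  have he1 : 0 < 1 + e := by linarith
  set g : H → H := fun w => (1 + e)⁻¹ • (T w + e • y) with hg
  have hmaps : MapsTo g D D := by
    intro w hw
    have := hDc (hTD w hw) hy (a := (1 + e)⁻¹) (b := e * (1 + e)⁻¹) (by positivity)
      (by positivity) (by field_simp)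
    convert this using 1
    simp only [hg]
    module
  have hcontr : ContractingWith (1 + e)⁻¹.toNNReal (hmaps.restrict g D D) := by
    refine ⟨by rw [Real.toNNReal_lt_one]; exact inv_lt_one_of_one_lt₀ (by linarith), ?_⟩
    refine LipschitzWith.of_dist_le_mul fun u v => ?_
    rw [Real.coe_toNNReal _ (by positivity), Subtype.dist_eq, Subtype.dist_eq, dist_eq_norm,
      dist_eq_norm, MapsTo.val_restrict_apply, MapsTo.val_restrict_apply]
    simp only [hg]
    rw [← smul_sub, add_sub_add_right_eq_sub, norm_smul, Real.norm_of_nonneg (by positivity)]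
    gcongr
    exact hT _ u.2 _ v.2
  obtain ⟨w, hw, hfix, -⟩ := hcontr.exists_fixedPoint' hD.isComplete hmaps hy (edist_ne_top _ _)
  refine ⟨w, hw, ?_⟩
  have h : g w = w := hfix
  calc (1 + e) • w = (1 + e) • g w := by rw [h]
    _ = _ := by simp only [hg]; rw [smul_inv_smul₀ he1.ne']

/-- The Tikhonov path of a nonexpansive self-map of a closed convex set converges strongly to the
fixed point nearest to the anchor. -/
theorem exists_tikhonov_path [CompleteSpace H] {D : Set H} (hD : IsClosed D) (hDc : Convex ℝ D)
    {T : H → H} (hTD : ∀ u ∈ D, T u ∈ D) (hT : ∀ u ∈ D, ∀ v ∈ D, ‖T u - T v‖ ≤ ‖u - v‖)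
    {y : H} (hy : y ∈ D) {p₀ : H} (hp₀ : p₀ ∈ D) (hTp₀ : T p₀ = p₀) :
    ∃ (w : ℝ → H) (q : H) (R : ℝ), 0 ≤ R ∧
      (∀ e, 0 < e → w e ∈ D ∧ (1 + e) • w e = T (w e) + e • y) ∧
      (∀ e d, 0 < e → 0 < d → ‖w e - w d‖ ≤ R / d * |e - d|) ∧
      Tendsto w (𝓝[>] 0) (𝓝 q) ∧ q ∈ D ∧ T q = q ∧
      ∀ p ∈ D, T p = p → inner ℝ (q - y) (q - p) ≤ 0 := by
  have hex : ∀ e : ℝ, ∃ w, 0 < e → w ∈ D ∧ (1 + e) • w = T w + e • y := fun e => by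
    by_cases he : 0 < e
    · obtain ⟨w, hw⟩ := exists_tikhonov_point hD hDc hTD hT hy he
      exact ⟨w, fun _ => hw⟩
    · exact ⟨y, fun h => absurd h he⟩
  choose w hw using hex
  have hres : ∀ e, 0 < e → w e - T (w e) = -(e • (w e - y)) := fun e he => by
    rw [eq_sub_of_add_eq (hw e he).2.symm]
    module
  have hmono : ∀ e d, 0 < e → 0 < d →
      inner ℝ (e • (w e - y) - d • (w d - y)) (w e - w d) ≤ 0 := fun e d he hd => by
    have h := inner_id_sub_nonneg hT (hw e he).1 (hw d hd).1
    rw [hres e he, hres d hd, show -(e • (w e - y)) - -(d • (w d - y))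
      = -(e • (w e - y) - d • (w d - y)) by abel, inner_neg_left] at h
    linarith
  have hfix : ∀ e, 0 < e → ∀ p ∈ D, T p = p → inner ℝ (w e - y) (w e - p) ≤ 0 := by
    intro e he p hp hTp
    have h := inner_id_sub_nonneg hT (hw e he).1 hp
    rw [hres e he, hTp, sub_self, sub_zero, inner_neg_left, inner_smul_left, conj_trivial] at h
    exact nonpos_of_mul_nonpos_right (by linarith) he
  have hbound : ∀ e, 0 < e → ‖w e - y‖ ≤ ‖p₀ - y‖ := by
    intro e he
    have h1 := hfix e he p₀ hp₀ hTp₀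
    rw [← sub_sub_sub_cancel_right (w e) p₀ y, inner_sub_right, real_inner_self_eq_norm_sq] at h1
    have h2 := real_inner_le_norm (w e - y) (p₀ - y)
    by_contra! hlt
    nlinarith [norm_nonneg (p₀ - y)]
  -- Monotonicity of id - T at two path points. Both the Cauchy property at 0 and the Lipschitz
  -- estimate follow from this inequality.
  have hkey : ∀ e d, 0 < e → 0 < d →
      d * ‖w e - w d‖ ^ 2 ≤ -((e - d) * inner ℝ (w e - y) (w e - w d)) := fun e d he hd => by
    have h := hmono e d he hd
    rw [show e • (w e - y) - d • (w d - y) = (e - d) • (w e - y) + d • (w e - w d) by module,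
      inner_add_left, inner_smul_left, inner_smul_left, real_inner_self_eq_norm_sq] at h
    simp only [conj_trivial] at h
    linarith
  have hsq : ∀ e d, 0 < d → d < e → ‖w e - w d‖ ^ 2 ≤ ‖w d - y‖ ^ 2 - ‖w e - y‖ ^ 2 := by
    intro e d hd hde
    have h := hkey e d (hd.trans hde) hd
    have h1 : inner ℝ (w e - y) (w e - w d) ≤ 0 := by
      have : 0 ≤ d * ‖w e - w d‖ ^ 2 := by positivity
      exact nonpos_of_mul_nonpos_right (a := e - d) (by linarith) (by linarith)
    have h2 := norm_sub_sq_real (w e - y) (w e - w d)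
    rw [show w e - y - (w e - w d) = w d - y by abel] at h2
    linarith
  have hcauchy : Cauchy (map w (𝓝[>] 0)) := by
    rw [Metric.cauchy_iff]
    refine ⟨inferInstance, fun η hη => ?_⟩
    -- By `hsq`, ‖w e - y‖² grows as e decreases. It is bounded, so it approaches its supremum, and
    -- its increments control distances along the path.
    set S : Set ℝ := (fun e => ‖w e - y‖ ^ 2) '' Ioi 0
    have hSb : BddAbove S := ⟨‖p₀ - y‖ ^ 2, by
      rintro _ ⟨e, he, rfl⟩
      exact pow_le_pow_left₀ (norm_nonneg _) (hbound e he) 2⟩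
    have hSn : S.Nonempty := ⟨_, 1, mem_Ioi.mpr one_pos, rfl⟩
    obtain ⟨_, ⟨e, he, rfl⟩, hlt⟩ := exists_lt_of_lt_csSup hSn
      (show sSup S - (η / 2) ^ 2 < sSup S from sub_lt_self _ (by positivity))
    have hclose : ∀ d ∈ Ioo 0 e, dist (w d) (w e) < η / 2 := by
      intro d hd
      rw [dist_comm, dist_eq_norm]
      refine lt_of_pow_lt_pow_left₀ 2 (by positivity) ?_
      have h1 : ‖w d - y‖ ^ 2 ≤ sSup S := le_csSup hSb ⟨d, hd.1, rfl⟩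
      linarith [hsq e d hd.1 hd.2]
    refine ⟨w '' Ioo 0 e, image_mem_map (Ioo_mem_nhdsGT he), ?_⟩
    rintro _ ⟨a, ha, rfl⟩ _ ⟨b, hb, rfl⟩
    have := dist_triangle_right (w a) (w b) (w e)
    linarith [hclose a ha, hclose b hb]
  obtain ⟨q, hq⟩ := CompleteSpace.complete hcauchy
  have hwq : Tendsto w (𝓝[>] 0) (𝓝 q) := hq
  have hqD : q ∈ D := hD.mem_of_tendsto hwq
    (eventually_nhdsWithin_of_forall fun e he => (hw e he).1)
  have he0 : Tendsto (fun e : ℝ => e) (𝓝[>] 0) (𝓝 0) := nhdsWithin_le_nhds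
  have hTq : T q = q := by
    have h1 : Tendsto (fun e => T (w e)) (𝓝[>] 0) (𝓝 (T q)) := by
      rw [tendsto_iff_norm_sub_tendsto_zero] at hwq ⊢
      exact squeeze_zero' (Eventually.of_forall fun _ => norm_nonneg _)
        (eventually_nhdsWithin_of_forall fun e he => hT _ (hw e he).1 _ hqD) hwq
    have h2 : Tendsto (fun e => T (w e)) (𝓝[>] 0) (𝓝 q) := by
      have h3 : Tendsto (fun e : ℝ => (1 + e) • w e - e • y) (𝓝[>] 0)
          (𝓝 ((1 + 0 : ℝ) • q - (0 : ℝ) • y)) :=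
        ((he0.const_add 1).smul hwq).sub (he0.smul_const y)
      simp only [add_zero, one_smul, zero_smul, sub_zero] at h3
      refine h3.congr' (eventually_nhdsWithin_of_forall fun e he => ?_)
      rw [(hw e he).2, add_sub_cancel_right]
    exact tendsto_nhds_unique h1 h2
  refine ⟨w, q, ‖p₀ - y‖, norm_nonneg _, hw, ?_, hwq, hqD, hTq, fun p hp hTp => ?_⟩
  · intro e d he hd
    have h1 := hkey e d he hd
    have h2 : -((e - d) * inner ℝ (w e - y) (w e - w d)) ≤
        |e - d| * (‖p₀ - y‖ * ‖w e - w d‖) := by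
      refine (neg_le_abs _).trans ?_
      rw [abs_mul]
      gcongr
      exact (abs_real_inner_le_norm _ _).trans (by gcongr; exact hbound e he)
    rw [div_mul_eq_mul_div, le_div_iff₀ hd]
    by_contra! hlt
    have h3 : 0 ≤ ‖p₀ - y‖ * |e - d| := by positivity
    have h4 : 0 < ‖w e - w d‖ := by
      by_contra! h0
      nlinarith [norm_nonneg (w e - w d)]
    nlinarith
  · exact le_of_tendsto ((hwq.sub_const y).inner (hwq.sub_const p))
      (eventually_nhdsWithin_of_forall fun e he => hfix e he p hp hTp)

end Tikhonov

/-! ### Absolute continuity and differential inequalities. -/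

section AbsolutelyContinuous

lemma AbsolutelyContinuousOnInterval.of_dist_le {X Y : Type*} [PseudoMetricSpace X]
    [PseudoMetricSpace Y] {f : ℝ → X} {g : ℝ → Y} {a b : ℝ}
    (hg : AbsolutelyContinuousOnInterval g a b)
    (h : ∀ s ∈ uIcc a b, ∀ t ∈ uIcc a b, dist (f s) (f t) ≤ dist (g s) (g t)) :
    AbsolutelyContinuousOnInterval f a b := by
  rw [absolutelyContinuousOnInterval_iff] at hg ⊢
  intro η hη
  obtain ⟨δ, hδ, hgδ⟩ := hg η hη
  refine ⟨δ, hδ, fun E hE hlen => (Finset.sum_le_sum fun i hi => ?_).trans_lt (hgδ E hE hlen)⟩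
  exact h _ (hE.1 i hi).1 _ (hE.1 i hi).2

lemma AbsolutelyContinuousOnInterval.norm {E : Type*} [NormedAddCommGroup E] {f : ℝ → E} {a b : ℝ}
    (hf : AbsolutelyContinuousOnInterval f a b) :
    AbsolutelyContinuousOnInterval (fun t => ‖f t‖) a b :=
  hf.of_dist_le fun s _ t _ => (dist_norm_norm_le (f s) (f t)).trans_eq (dist_eq_norm _ _).symm

lemma AbsolutelyContinuousOnInterval.le_of_ae_deriv_nonpos {u : ℝ → ℝ} {a b : ℝ} (hab : a ≤ b)
    (hu : AbsolutelyContinuousOnInterval u a b)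
    (h : ∀ᵐ t, t ∈ Ioc a b → deriv u t ≤ 0) : u b ≤ u a := by
  have h1 := hu.integral_deriv_eq_sub
  rw [intervalIntegral.integral_of_le hab] at h1
  have h2 : ∫ t in Ioc a b, deriv u t ≤ 0 := by
    refine integral_nonpos_of_ae ?_
    rw [EventuallyLE, ae_restrict_iff' measurableSet_Ioc]
    exact h
  linarith

lemma LocallyAC.mono {E : Type*} [NormedAddCommGroup E] {f : ℝ → E} (hf : LocallyAC f) {a b : ℝ}
    (ha : 0 ≤ a) (hab : a ≤ b) : AbsolutelyContinuousOnInterval f a b := by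
  refine (hf (b + 1) (by linarith)).mono ?_
  rw [uIcc_of_le hab, uIcc_of_le (by linarith)]
  exact Icc_subset_Icc ha (by linarith)

lemma continuousOn_Ici_of_Icc {X : Type*} [TopologicalSpace X] {f : ℝ → X}
    (hf : ∀ T : ℝ, 0 < T → ContinuousOn f (Icc 0 T)) : ContinuousOn f (Ici 0) := by
  intro t ht
  have h0 : (0 : ℝ) ≤ t := ht
  refine (hf (t + 1) (by linarith) t ⟨h0, by linarith⟩).mono_of_mem_nhdsWithin ?_
  rw [mem_nhdsWithin]
  exact ⟨Iio (t + 1), isOpen_Iio, by simp, fun s hs => ⟨hs.2, (mem_Iio.mp hs.1).le⟩⟩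

lemma LocallyAC.continuousOn {E : Type*} [NormedAddCommGroup E] {f : ℝ → E} (hf : LocallyAC f) :
    ContinuousOn f (Ici 0) :=
  continuousOn_Ici_of_Icc fun T hT => by simpa only [uIcc_of_le hT.le] using (hf T hT).continuousOn

lemma LocallyAC.ae_differentiableAt {f : ℝ → ℝ} (hf : LocallyAC f) :
    ∀ᵐ t, 0 ≤ t → DifferentiableAt ℝ f t := by
  have h : ∀ n : ℕ, ∀ᵐ t, t ∈ uIcc (0 : ℝ) (n + 1) → DifferentiableAt ℝ f t := fun n =>
    (hf (n + 1) (by positivity)).ae_differentiableAt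
  filter_upwards [ae_all_iff.mpr h] with t ht h0
  obtain ⟨n, hn⟩ := exists_nat_ge t
  refine ht n ?_
  rw [uIcc_of_le (by positivity)]
  exact ⟨h0, by linarith⟩

variable {u ε : ℝ → ℝ}

lemma hasDerivAt_exp_integral (hε : Continuous ε) (a t : ℝ) :
    HasDerivAt (fun t => Real.exp (∫ s in a..t, ε s)) (Real.exp (∫ s in a..t, ε s) * ε t) t :=
  (hε.integral_hasStrictDerivAt a t).hasDerivAt.exp

lemma contDiff_exp_integral (hε : Continuous ε) (a : ℝ) :
    ContDiff ℝ 1 (fun t => Real.exp (∫ s in a..t, ε s)) := by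
  refine Real.contDiff_exp.comp (contDiff_one_iff_deriv.mpr ⟨fun t =>
    (hε.integral_hasStrictDerivAt a t).hasDerivAt.differentiableAt, ?_⟩)
  rwa [show deriv (fun t => ∫ s in a..t, ε s) = ε from
    funext fun t => (hε.integral_hasStrictDerivAt a t).hasDerivAt.deriv]

/-- The product (u - δ) exp(∫ε) is absolutely continuous with nonpositive derivative almost
everywhere. -/
lemma gronwall_of_ae_deriv_le (hu : LocallyAC u) (hε : Continuous ε) {a δ : ℝ} (ha : 0 ≤ a)
    (h : ∀ᵐ t, a < t → deriv u t ≤ ε t * (δ - u t)) {t : ℝ} (ht : a ≤ t) :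
    u t ≤ δ + (u a - δ) * Real.exp (-∫ s in a..t, ε s) := by
  set G : ℝ → ℝ := fun t => Real.exp (∫ s in a..t, ε s) with hG
  have hGac : AbsolutelyContinuousOnInterval G a t :=
    (contDiff_exp_integral hε a).contDiffOn.absolutelyContinuousOnInterval
  have hconst : AbsolutelyContinuousOnInterval (fun _ : ℝ => δ) a t :=
    contDiffOn_const.absolutelyContinuousOnInterval
  have hm := ((hu.mono ha ht).fun_sub hconst).fun_mul hGac
  have hle := hm.le_of_ae_deriv_nonpos ht (by
    filter_upwards [h, hu.ae_differentiableAt] with s hs hd hmem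
    have hd1 := ((hd (ha.trans hmem.1.le)).hasDerivAt.sub_const δ).fun_mul
      (hasDerivAt_exp_integral hε a s)
    rw [hd1.deriv]
    have hpos : 0 < G s := Real.exp_pos _
    have := mul_le_mul_of_nonneg_right (hs hmem.1) hpos.le
    simp only [hG] at this
    linarith)
  simp only [hG, intervalIntegral.integral_same, Real.exp_zero, mul_one] at hle
  have hpos := Real.exp_pos (∫ s in a..t, ε s)
  rw [Real.exp_neg, ← div_eq_mul_inv, ← sub_le_iff_le_add', le_div_iff₀ hpos]
  exact hle

lemma tendsto_zero_of_ae_deriv_le (hu : LocallyAC u) (hu0 : ∀ t, 0 ≤ u t) (hε : Continuous ε)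
    (hint : Tendsto (fun T : ℝ => ∫ s in (0 : ℝ)..T, ε s) atTop atTop)
    (h : ∀ δ > 0, ∃ a, 0 ≤ a ∧ ∀ᵐ t, a < t → deriv u t ≤ ε t * (δ - u t)) :
    Tendsto u atTop (𝓝 0) := by
  refine tendsto_order.mpr ⟨fun b hb => Eventually.of_forall fun t => hb.trans_le (hu0 t),
    fun η hη => ?_⟩
  obtain ⟨a, ha, hder⟩ := h (η / 2) (by positivity)
  have hint' : Tendsto (fun T : ℝ => ∫ s in a..T, ε s) atTop atTop := by
    refine (tendsto_atTop_add_const_right _ (-∫ s in (0 : ℝ)..a, ε s) hint).congr fun T => ?_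
    rw [← sub_eq_add_neg, intervalIntegral.integral_interval_sub_left
      (hε.intervalIntegrable _ _) (hε.intervalIntegrable _ _)]
  have hlim : Tendsto (fun T : ℝ => η / 2 + (u a - η / 2) * Real.exp (-∫ s in a..T, ε s)) atTop
      (𝓝 (η / 2 + (u a - η / 2) * 0)) :=
    (((Real.tendsto_exp_atBot.comp (tendsto_neg_atTop_atBot.comp hint')).const_mul _).const_add _)
  rw [mul_zero, add_zero] at hlim
  filter_upwards [hlim.eventually_lt_const (half_lt_self hη), eventually_ge_atTop a] with t h1 h2
  exact (gronwall_of_ae_deriv_le hu hε ha hder h2).trans_lt h1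

/-- Bounds the derivative of a distance to a moving point w without differentiating w: its motion is
only dominated by that of a scalar ρ. Since u' is assumed to exist, right difference quotients
suffice, with x(s) replaced by an Euler step from x(t). -/
lemma deriv_norm_sub_le {E : Type*} [NormedAddCommGroup E] [NormedSpace ℝ E] {x w : ℝ → E}
    {ρ : ℝ → ℝ} {t u' ρ' M C : ℝ} {x' : E} (hx : HasDerivAt x x' t)
    (hu : HasDerivAt (fun s => ‖x s - w s‖) u' t) (hρ : HasDerivAt ρ ρ' t)
    (hw : ∀ᶠ s in 𝓝[>] t, ‖w s - w t‖ ≤ C * |ρ s - ρ t|)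
    (hstep : ∀ᶠ h in 𝓝[>] (0 : ℝ), ‖x t + h • x' - w t‖ ≤ ‖x t - w t‖ + h * M) :
    u' ≤ M + C * |ρ'| := by
  have hu1 := hu.tendsto_slope.mono_left (nhdsGT_le_nhdsNE t)
  have hx1 := hx.tendsto_slope.mono_left (nhdsGT_le_nhdsNE t)
  have hρ1 := hρ.tendsto_slope.mono_left (nhdsGT_le_nhdsNE t)
  have hlim : Tendsto (fun s => ‖slope x t s - x'‖ + (M + C * |slope ρ t s|)) (𝓝[>] t)
      (𝓝 (‖x' - x'‖ + (M + C * |ρ'|))) :=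
    (hx1.sub_const x').norm.add ((hρ1.abs.const_mul C).const_add M)
  rw [sub_self, norm_zero, zero_add] at hlim
  have hshift : Tendsto (fun s : ℝ => s - t) (𝓝[>] t) (𝓝[>] 0) := by
    refine tendsto_nhdsWithin_iff.mpr ⟨?_, eventually_nhdsWithin_of_forall fun s hs =>
      mem_Ioi.mpr (sub_pos.mpr hs)⟩
    have : Continuous fun s : ℝ => s - t := by fun_prop
    simpa using (this.tendsto t).mono_left nhdsWithin_le_nhds
  refine le_of_tendsto_of_tendsto hu1 hlim ?_
  filter_upwards [hw, hshift.eventually hstep, self_mem_nhdsWithin] with s h1 h2 hs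
  have hst : 0 < s - t := sub_pos.mpr hs
  have h3 : ‖x s - x t - (s - t) • x'‖ = (s - t) * ‖slope x t s - x'‖ := by
    rw [← Real.norm_of_nonneg hst.le, ← norm_smul, Real.norm_of_nonneg hst.le, smul_sub,
      sub_smul_slope, vsub_eq_sub]
  have h4 : |ρ s - ρ t| = (s - t) * |slope ρ t s| := by
    rw [← sub_smul_slope ρ t s |>.trans (vsub_eq_sub _ _), smul_eq_mul, abs_mul, abs_of_pos hst]
  have h5 : ‖x s - w s‖ ≤ ‖x s - x t - (s - t) • x'‖ + ‖x t + (s - t) • x' - w t‖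
      + ‖w s - w t‖ := by
    rw [show x s - w s = (x s - x t - (s - t) • x') + (x t + (s - t) • x' - w t) - (w s - w t)
      by abel]
    exact (norm_sub_le _ _).trans (by gcongr; exact norm_add_le _ _)
  rw [slope_def_field, div_le_iff₀ hst]
  rw [h4] at h1
  rw [h3] at h5
  linarith

end AbsolutelyContinuous

/-! ### Uniqueness and strong convergence of trajectories. -/

section Convergence

variable {H : Type*} [NormedAddCommGroup H] [InnerProductSpace ℝ H]

/-- For small h the step is (1 - h(1 + e))d + hτ with nonnegative weights, so the triangle
inequality loses nothing of the damping -e‖d‖. -/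
lemma eventually_norm_euler_step_le {d τ : H} {e r : ℝ} (he : 0 ≤ e) (hτ : ‖τ‖ ≤ ‖d‖ + r) :
    ∀ᶠ h in 𝓝[>] (0 : ℝ), ‖d + h • (τ - (1 + e) • d)‖ ≤ ‖d‖ + h * (r - e * ‖d‖) := by
  have he1 : 0 < 1 + e := by linarith
  filter_upwards [Ioo_mem_nhdsGT (inv_pos.mpr he1)] with h hh
  have h1 : 0 ≤ 1 - h * (1 + e) := by
    have := mul_le_mul_of_nonneg_right hh.2.le he1.le
    rw [inv_mul_cancel₀ he1.ne'] at this
    linarith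
  calc ‖d + h • (τ - (1 + e) • d)‖ = ‖(1 - h * (1 + e)) • d + h • τ‖ := by congr 1; module
    _ ≤ (1 - h * (1 + e)) * ‖d‖ + h * ‖τ‖ := by
      refine (norm_add_le _ _).trans_eq ?_
      rw [norm_smul, norm_smul, Real.norm_of_nonneg h1, Real.norm_of_nonneg hh.1.le]
    _ ≤ (1 - h * (1 + e)) * ‖d‖ + h * (‖d‖ + r) := by
      gcongr
      exact hh.1.le
    _ = _ := by ring

variable {D : Set H} {Φt : ℝ → H → EReal} {Bt : ℝ → H → H} {μ : ℝ} {ε : ℝ → ℝ} {y x₀ : H}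

lemma ae_pos_of_ae_restrict_Ici {P : ℝ → Prop}
    (h : ∀ᵐ t ∂(volume.restrict (Ici (0 : ℝ))), P t) : ∀ᵐ t, 0 < t → P t := by
  rw [ae_restrict_iff' measurableSet_Ici] at h
  filter_upwards [h] with t ht h0
  exact ht h0.le

theorem IsTrajectory.eqOn {x₁ x₂ : ℝ → H}
    (hT : ∀ t, 0 < t → ∀ u ∈ D, ∀ v ∈ D, ‖forwardBackward μ (Φt t) (Bt t) u -
      forwardBackward μ (Φt t) (Bt t) v‖ ≤ ‖u - v‖) (hε : ∀ t, 0 ≤ t → 0 ≤ ε t)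
    (h₁ : IsTrajectory D Φt Bt μ ε y x₀ x₁) (h₂ : IsTrajectory D Φt Bt μ ε y x₀ x₂) :
    EqOn x₁ x₂ (Ici 0) := by
  set u : ℝ → ℝ := fun t => ‖x₁ t - x₂ t‖ with hu
  have huac : LocallyAC u := fun T hT => ((h₁.locallyAC T hT).fun_sub (h₂.locallyAC T hT)).norm
  have hder : ∀ᵐ t, 0 < t → deriv u t ≤ 0 := by
    filter_upwards [ae_pos_of_ae_restrict_Ici h₁.ode, ae_pos_of_ae_restrict_Ici h₂.ode,
      huac.ae_differentiableAt] with t hd₁ hd₂ hdu ht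
    have hstep := eventually_norm_euler_step_le (r := 0) (hε t ht.le)
      ((hT t ht _ (h₁.mem t ht.le) _ (h₂.mem t ht.le)).trans_eq (add_zero _).symm)
    have hu' := (hdu ht.le).hasDerivAt
    -- The difference of the solutions is compared with the motionless point 0.
    have key := deriv_norm_sub_le (x := fun s => x₁ s - x₂ s) (w := fun _ => 0) (ρ := fun _ => 0)
      (C := 0) ((hd₁ ht).fun_sub (hd₂ ht)) (by simpa only [sub_zero] using hu')
      (hasDerivAt_const t 0) (by simp) (M := 0 - ε t * ‖x₁ t - x₂ t‖) (by
        filter_upwards [hstep] with h hh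
        rw [sub_zero, sub_zero]
        refine le_trans (le_of_eq ?_) hh
        congr 3
        simp only [forwardBackward]
        module)
    have := mul_nonneg (hε t ht.le) (norm_nonneg (x₁ t - x₂ t))
    linarith
  intro t ht
  have hle := (huac.mono le_rfl ht).le_of_ae_deriv_nonpos ht (by
    filter_upwards [hder] with s hs hmem using hs hmem.1)
  simp only [hu, h₁.init, h₂.init, sub_self, norm_zero] at hle
  exact sub_eq_zero.mp (norm_le_zero_iff.mp hle)

/-- The intermediate point prox_{μΦ}(u - μB_t u) splits the error into a proximal part, governed by
κ, and a part at most μ‖B_t u - Bu‖. Each is at most ηε/2. -/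
lemma eventually_norm_forwardBackward_sub_le [CompleteSpace H] {Φ : H → EReal} {B : H → H} {β : ℝ} {κ : ℝ → ℝ}
    {c p : ℝ} {K : Set H} (hΦ : ProperConvexLsc Φ)
    (hBt : ∀ t : ℝ, 0 < t → CocoerciveOn β (Bt t) D) (hB : CocoerciveOn β B D)
    (hβ : 0 < β) (hμ : 0 < μ) (hεpos : ∀ t : ℝ, 0 ≤ t → 0 < ε t) (hεlim : Tendsto ε atTop (𝓝 0))
    (hκ : ∀ t : ℝ, 0 < t → 0 ≤ κ t) (hc : 0 < c) (hp : 0 < p)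
    (hprox : ∀ t : ℝ, 0 < t → ∀ z : H, ‖prox μ (Φt t) z - prox μ Φ z‖ ≤ κ t * (‖z‖ + c) ^ p)
    (hκε : Tendsto (fun t : ℝ => κ t / ε t) atTop (𝓝 0)) (hK : IsCompact K) (hKD : K ⊆ D)
    (hBK : Tendsto (fun t : ℝ => 1 / ε t * ⨆ x : K, ‖Bt t x - B x‖) atTop (𝓝 0))
    {η : ℝ} (hη : 0 < η) :
    ∀ᶠ t in atTop, ∀ u ∈ K,
      ‖forwardBackward μ (Φt t) (Bt t) u - forwardBackward μ Φ B u‖ ≤ η * ε t := by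
  obtain ⟨N, hN⟩ := hK.exists_bound_of_continuousOn (f := fun u : H => u) continuousOn_id
  obtain ⟨M, hM⟩ := hK.exists_bound_of_continuousOn ((hB.continuousOn hβ).mono hKD)
  -- Bounds (‖u - μB_t u‖ + c)^p over K once B_t is within 1 of B there.
  set A : ℝ := (N + μ * (M + 1) + c) ^ p with hA
  have h1 : ∀ᶠ t in atTop, κ t / ε t < η / 2 / (|A| + 1) :=
    hκε.eventually_lt_const (by positivity)
  have h2 : ∀ᶠ t in atTop, 1 / ε t * ⨆ x : K, ‖Bt t x - B x‖ < min 1 (η / 2 / μ) :=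
    hBK.eventually_lt_const (by positivity)
  filter_upwards [h1, h2, hεlim.eventually_lt_const one_pos, eventually_gt_atTop 0]
    with t ht1 ht2 ht3 ht u hu
  have hεt := hεpos t ht.le
  -- A real supremum of an unbounded family is 0 by convention; continuity on K rules this out.
  have hbdd : BddAbove (range fun x : K => ‖Bt t x - B x‖) := by
    have := hK.bddAbove_image (f := fun x => ‖Bt t x - B x‖)
      ((((hBt t ht).continuousOn hβ).mono hKD).sub ((hB.continuousOn hβ).mono hKD)).norm
    rwa [image_eq_range] at this
  have hBu : ‖Bt t u - B u‖ ≤ ⨆ x : K, ‖Bt t x - B x‖ := le_ciSup hbdd ⟨u, hu⟩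
  rw [one_div, inv_mul_lt_iff₀ hεt] at ht2
  have hB1 : ‖Bt t u - B u‖ ≤ 1 := by
    have : ε t * min 1 (η / 2 / μ) ≤ ε t * 1 := by gcongr; exact min_le_left _ _
    linarith
  have hB2 : μ * ‖Bt t u - B u‖ ≤ η / 2 * ε t := by
    have h3 : ε t * min 1 (η / 2 / μ) ≤ ε t * (η / 2 / μ) := by gcongr; exact min_le_right _ _
    have h4 := mul_le_mul_of_nonneg_left ((hBu.trans ht2.le).trans h3) hμ.le
    refine h4.trans_eq ?_
    field_simp
  have hz : ‖u - μ • Bt t u‖ ≤ N + μ * (M + 1) := by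
    have h3 : ‖Bt t u‖ ≤ M + 1 := by
      have := norm_add_le (B u) (Bt t u - B u)
      rw [add_sub_cancel] at this
      linarith [hM u hu]
    refine (norm_sub_le _ _).trans ?_
    rw [norm_smul, Real.norm_of_nonneg hμ.le]
    gcongr
    exact hN u hu
  have hpow : (‖u - μ • Bt t u‖ + c) ^ p ≤ |A| :=
    (Real.rpow_le_rpow (by positivity) (by gcongr) hp.le).trans (le_abs_self A)
  have hκA : κ t * (‖u - μ • Bt t u‖ + c) ^ p ≤ η / 2 * ε t := by
    rw [div_lt_div_iff₀ hεt (by positivity)] at ht1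
    have h3 := mul_le_mul_of_nonneg_left hpow (hκ t ht)
    linarith [hκ t ht]
  have hnonexp := hΦ.norm_prox_sub_prox_le hμ (u - μ • Bt t u) (u - μ • B u)
  rw [sub_sub_sub_cancel_left, ← smul_sub, norm_smul, Real.norm_of_nonneg hμ.le,
    norm_sub_rev (B u)]
    at hnonexp
  have htri := norm_sub_le_norm_sub_add_norm_sub (prox μ (Φt t) (u - μ • Bt t u))
    (prox μ Φ (u - μ • Bt t u)) (prox μ Φ (u - μ • B u))
  simp only [forwardBackward]
  linarith [hprox t ht (u - μ • Bt t u)]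

/-- The value w 0 is arbitrary and is replaced by the limit q. The constant R/d blows up at 0, so
continuity there comes from convergence instead. -/
lemma isCompact_range_tikhonov {E : Type*} [NormedAddCommGroup E] {w : ℝ → E} {q : E} {R b : ℝ}
    (hlip : ∀ e d, 0 < e → 0 < d → ‖w e - w d‖ ≤ R / d * |e - d|)
    (hwq : Tendsto w (𝓝[>] 0) (𝓝 q)) :
    IsCompact (Function.update w 0 q '' Icc 0 b) := by
  refine isCompact_Icc.image_of_continuousOn fun d hd => ?_
  rcases hd.1.eq_or_lt with rfl | hd0
  · refine (continuousWithinAt_update_same.mpr ?_)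
    refine hwq.mono_left (nhdsWithin_mono _ fun s hs => ?_)
    exact lt_of_le_of_ne hs.1.1 (Ne.symm hs.2)
  · refine ContinuousAt.continuousWithinAt ?_
    rw [continuousAt_update_of_ne hd0.ne', ContinuousAt, tendsto_iff_norm_sub_tendsto_zero]
    have hc : Continuous fun e : ℝ => R / d * |e - d| := by fun_prop
    have hlim : Tendsto (fun e : ℝ => R / d * |e - d|) (𝓝 d) (𝓝 0) := by
      simpa using hc.tendsto d
    refine squeeze_zero' (Eventually.of_forall fun _ => norm_nonneg _) ?_ hlim
    filter_upwards [lt_mem_nhds hd0] with e he using hlip e d he hd0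

theorem IsTrajectory.tendsto_of_tikhonov_path {T : H → H} {w : ℝ → H} {q : H} {R : ℝ} (hR : 0 ≤ R)
    (hw : ∀ e, 0 < e → w e ∈ D ∧ (1 + e) • w e = T (w e) + e • y)
    (hlip : ∀ e d, 0 < e → 0 < d → ‖w e - w d‖ ≤ R / d * |e - d|)
    (hwq : Tendsto w (𝓝[>] 0) (𝓝 q))
    (hT : ∀ t, 0 < t → ∀ u ∈ D, ∀ v ∈ D, ‖forwardBackward μ (Φt t) (Bt t) u -
      forwardBackward μ (Φt t) (Bt t) v‖ ≤ ‖u - v‖)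
    (hres : ∀ η > 0, ∀ᶠ t in atTop,
      ‖forwardBackward μ (Φt t) (Bt t) (w (ε t)) - T (w (ε t))‖ ≤ η * ε t)
    (hεpos : ∀ t : ℝ, 0 ≤ t → 0 < ε t) (hεac : LocallyAC ε)
    (hεanti : AntitoneOn ε (Ici 0)) (hεlim : Tendsto ε atTop (𝓝 0))
    (hεint : Tendsto (fun T : ℝ => ∫ s in (0 : ℝ)..T, ε s) atTop atTop)
    (hεderiv : Tendsto (fun t : ℝ => deriv ε t / ε t ^ 2) (atTop ⊓ ae volume) (𝓝 0))
    {x : ℝ → H} (hx : IsTrajectory D Φt Bt μ ε y x₀ x) : Tendsto x atTop (𝓝 q) := by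
  have hwε : Tendsto (fun t => w (ε t)) atTop (𝓝 q) := by
    refine hwq.comp (tendsto_nhdsWithin_iff.mpr ⟨hεlim, ?_⟩)
    filter_upwards [eventually_ge_atTop 0] with t ht using hεpos t ht
  have hwac : LocallyAC fun t => w (ε t) := by
    intro S hS
    -- On [0, S] the smallest value of ε is ε S, so R/ε S is a uniform Lipschitz constant.
    refine ((hεac S hS).const_mul (R / ε S)).of_dist_le fun s hs t ht => ?_
    rw [uIcc_of_le hS.le] at hs ht
    rw [dist_eq_norm, Real.dist_eq, ← mul_sub, abs_mul,
      abs_of_nonneg (div_nonneg hR (hεpos S hS.le).le)]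
    refine (hlip _ _ (hεpos s hs.1) (hεpos t ht.1)).trans ?_
    gcongr
    · exact hεpos S hS.le
    · exact hεanti ht.1 hS.le ht.2
  set u : ℝ → ℝ := fun t => ‖x t - w (ε t)‖ with hu
  have huac : LocallyAC u := fun S hS => ((hx.locallyAC S hS).fun_sub (hwac S hS)).norm
  set ε' : ℝ → ℝ := fun t => ε (max t 0) with hε'
  have hε'eq : ∀ t, 0 ≤ t → ε' t = ε t := fun t ht => by simp only [hε', max_eq_left ht]
  have hε'cont : Continuous ε' :=
    hεac.continuousOn.comp_continuous (by fun_prop) fun t =>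
      mem_Ici.mpr (le_max_right _ _)
  have hε'int : Tendsto (fun T : ℝ => ∫ s in (0 : ℝ)..T, ε' s) atTop atTop := by
    refine hεint.congr' ?_
    filter_upwards [eventually_ge_atTop 0] with S hS
    refine intervalIntegral.integral_congr fun s hs => ?_
    rw [uIcc_of_le hS] at hs
    exact (hε'eq s hs.1).symm
  have hu0 : Tendsto u atTop (𝓝 0) := by
    refine tendsto_zero_of_ae_deriv_le huac (fun t => norm_nonneg _) hε'cont hε'int
      fun δ hδ => ?_
    obtain ⟨a₁, ha₁⟩ := eventually_atTop.mp (hres (δ / 2) (by positivity))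
    -- R + 1 instead of R, since R may vanish. Half of δ pays for the motion of the path, half for
    -- the residual.
    have hder : ∀ᶠ t in atTop ⊓ ae volume, |deriv ε t / ε t ^ 2| < δ / 2 / (R + 1) := by
      have := hεderiv.abs
      rw [abs_zero] at this
      exact this.eventually_lt_const (by positivity)
    obtain ⟨s, hs, s', hs', hss⟩ := mem_inf_iff_superset.mp hder
    obtain ⟨a₂, ha₂⟩ := mem_atTop_sets.mp hs
    refine ⟨max 0 (max a₁ a₂), le_max_left _ _, ?_⟩
    filter_upwards [hs', ae_pos_of_ae_restrict_Ici hx.ode, huac.ae_differentiableAt,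
      hεac.ae_differentiableAt] with t hts' hode hdu hdε hat
    have ht : 0 < t := (le_max_left _ _).trans_lt hat
    have hta₁ : a₁ ≤ t := (le_max_left _ _).trans ((le_max_right _ _).trans hat.le)
    have hta₂ : a₂ ≤ t := (le_max_right _ _).trans ((le_max_right _ _).trans hat.le)
    have hεt := hεpos t ht.le
    have hd : |deriv ε t / ε t ^ 2| < δ / 2 / (R + 1) := hss ⟨ha₂ t hta₂, hts'⟩
    have hwt := hw _ hεt
    have hτ : ‖forwardBackward μ (Φt t) (Bt t) (x t) - T (w (ε t))‖ ≤
        ‖x t - w (ε t)‖ + δ / 2 * ε t := by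
      refine (norm_sub_le_norm_sub_add_norm_sub _
        (forwardBackward μ (Φt t) (Bt t) (w (ε t))) _).trans ?_
      gcongr
      · exact hT t ht _ (hx.mem t ht.le) _ hwt.1
      · exact ha₁ t hta₁
    have key := deriv_norm_sub_le (C := R / ε t) (hode ht) (hdu ht.le).hasDerivAt
      (hdε ht.le).hasDerivAt (by
        filter_upwards [self_mem_nhdsWithin] with s hs
        exact hlip _ _ (hεpos s (ht.trans hs).le) hεt)
      (M := δ / 2 * ε t - ε t * ‖x t - w (ε t)‖) (by
        filter_upwards [eventually_norm_euler_step_le hεt.le hτ] with h hh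
        refine le_trans (le_of_eq ?_) hh
        rw [eq_sub_of_add_eq hwt.2.symm]
        congr 1
        simp only [forwardBackward]
        module)
    have hlast : R / ε t * |deriv ε t| ≤ δ / 2 * ε t := by
      rw [abs_div, abs_of_nonneg (sq_nonneg (ε t)), div_lt_div_iff₀ (by positivity)
        (by positivity)] at hd
      rw [div_mul_eq_mul_div, div_le_iff₀ hεt]
      nlinarith [abs_nonneg (deriv ε t)]
    rw [hε'eq t ht.le]
    simp only [hu] at key ⊢
    linarith
  have := (tendsto_zero_iff_norm_tendsto_zero.mpr hu0).add hwε
  simpa using this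

end Convergence

/-! ### Existence by Picard iteration. -/

section Existence

variable {H : Type*} [NormedAddCommGroup H]

lemma IntervalIntegrable.absolutelyContinuousOnInterval_integral {E : Type*}
    [NormedAddCommGroup E] [NormedSpace ℝ E] {g : ℝ → E} {a b : ℝ}
    (hg : IntervalIntegrable g volume a b) :
    AbsolutelyContinuousOnInterval (fun t => ∫ s in a..t, g s) a b := by
  refine (hg.norm.absolutelyContinuousOnInterval_intervalIntegral left_mem_uIcc).of_dist_le
    fun s hs t ht => ?_
  have hsub : ∀ r ∈ uIcc a b, IntervalIntegrable g volume a r := fun r hr =>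
    hg.mono_set (uIcc_subset_uIcc left_mem_uIcc hr)
  rw [dist_eq_norm, Real.dist_eq,
    intervalIntegral.integral_interval_sub_left (hsub s hs) (hsub t ht),
    intervalIntegral.integral_interval_sub_left (hsub s hs).norm (hsub t ht).norm]
  exact intervalIntegral.norm_integral_le_abs_integral_norm

/-- A time-dependent field of nonexpansive self-maps of `D`, locally integrable in time. -/
structure NonexpansiveField (D : Set H) (G : ℝ → H → H) : Prop where
  mapsTo : ∀ t, 0 < t → ∀ u ∈ D, G t u ∈ D
  norm_sub_le : ∀ t, 0 < t → ∀ u ∈ D, ∀ v ∈ D, ‖G t u - G t v‖ ≤ ‖u - v‖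
  locallyIntegrableOn : ∀ z ∈ D, LocallyIntegrableOn (fun t => G t z) (Ici 0)

namespace NonexpansiveField

variable {D : Set H} {G : ℝ → H → H} {x : ℝ → H} {ε : ℝ → ℝ} {x₀ y : H}

lemma integrableOn_Ioc (hG : NonexpansiveField D G) {z : H} (hz : z ∈ D) (T : ℝ) :
    IntegrableOn (fun t => G t z) (Ioc 0 T) :=
  ((hG.locallyIntegrableOn z hz).integrableOn_compact_subset Icc_subset_Ici_self
    isCompact_Icc).mono_set Ioc_subset_Icc_self

/-- Measurability in time is known only at a fixed point of D, so x is sampled at the grid times τ n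
t. Nonexpansiveness passes the convergence of the samples on to G. -/
lemma aestronglyMeasurable_comp (hG : NonexpansiveField D G) (hx : ContinuousOn x (Ici 0))
    (hxD : ∀ t, 0 ≤ t → x t ∈ D) (T : ℝ) :
    AEStronglyMeasurable (fun t => G t (x t)) (volume.restrict (Ioc 0 T)) := by
  set τ : ℕ → ℝ → ℝ := fun n t => (⌊t * ((n : ℝ) + 1)⌋₊ : ℝ) / ((n : ℝ) + 1) with hτ
  have hτ0 : ∀ n t, 0 ≤ τ n t := fun n t => by positivity
  refine aestronglyMeasurable_of_tendsto_ae atTop (f := fun n t => G t (x (τ n t))) ?_ ?_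
  · intro n
    set S : ℕ → Set ℝ := fun k => {t | ⌊t * ((n : ℝ) + 1)⌋₊ = k}
    have hS : ∀ k, MeasurableSet (S k) := fun k =>
      (Nat.measurable_floor.comp (measurable_id.mul_const ((n : ℝ) + 1)))
        (measurableSet_singleton k)
    have hU : (⋃ k, S k) = univ := eq_univ_of_forall fun t => mem_iUnion.mpr ⟨_, rfl⟩
    rw [← Measure.restrict_univ (μ := volume.restrict (Ioc 0 T)), ← hU,
      aestronglyMeasurable_iUnion_iff]
    intro k
    have hk := (hG.integrableOn_Ioc (hxD ((k : ℝ) / ((n : ℝ) + 1)) (by positivity)) T).1.restrict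
      (s := S k)
    refine hk.congr ?_
    filter_upwards [ae_restrict_mem (hS k)] with t ht
    have ht' : ⌊t * ((n : ℝ) + 1)⌋₊ = k := ht
    simp only [hτ, ht']
  · filter_upwards [ae_restrict_mem measurableSet_Ioc] with t ht
    have hlim : Tendsto (fun n => τ n t) atTop (𝓝[Ici 0] t) := by
      refine tendsto_nhdsWithin_iff.mpr ⟨?_, Eventually.of_forall fun n => hτ0 n t⟩
      exact (tendsto_nat_floor_mul_div_atTop ht.1.le).comp
        (tendsto_atTop_add_const_right _ 1 tendsto_natCast_atTop_atTop)
    have hxlim := (hx t ht.1.le).tendsto.comp hlim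
    rw [tendsto_iff_norm_sub_tendsto_zero] at hxlim ⊢
    exact squeeze_zero (fun _ => norm_nonneg _) (fun n =>
      hG.norm_sub_le t ht.1 _ (hxD _ (hτ0 n t)) _ (hxD t ht.1.le)) hxlim

lemma intervalIntegrable_comp (hG : NonexpansiveField D G) (hx : ContinuousOn x (Ici 0))
    (hxD : ∀ t, 0 ≤ t → x t ∈ D) {T : ℝ} (hT : 0 ≤ T) :
    IntervalIntegrable (fun t => G t (x t)) volume 0 T := by
  rw [intervalIntegrable_iff_integrableOn_Ioc_of_le hT]
  obtain ⟨C, hC⟩ := isCompact_Icc.exists_bound_of_continuousOn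
    ((hx.mono (Icc_subset_Ici_self (a := T))).sub (continuousOn_const (c := x 0)))
  refine Integrable.mono' (g := fun t => ‖G t (x 0)‖ + C)
    ((hG.integrableOn_Ioc (hxD 0 le_rfl) T).norm.add (integrable_const C))
    (hG.aestronglyMeasurable_comp hx hxD T) ?_
  filter_upwards [ae_restrict_mem measurableSet_Ioc] with t ht
  have h1 := hG.norm_sub_le t ht.1 _ (hxD t ht.1.le) _ (hxD 0 le_rfl)
  have h2 := norm_sub_norm_le (G t (x t)) (G t (x 0))
  have h3 := hC t ⟨ht.1.le, ht.2⟩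
  simp only [Pi.sub_apply] at h3
  linarith

variable [NormedSpace ℝ H]

/-- The integrating factor of `x' + (1 + ε) x = G + ε y`. -/
noncomputable def factor (ε : ℝ → ℝ) (t : ℝ) : ℝ := Real.exp (∫ s in (0 : ℝ)..t, (1 + ε s))

/-- The integrand in the variation of constants formula. -/
noncomputable def integrand (G : ℝ → H → H) (ε : ℝ → ℝ) (y : H) (x : ℝ → H) (s : ℝ) : H :=
  factor ε s • (G s (x s) + ε s • y)

/-- The Picard operator given by the variation of constants formula. -/
noncomputable def picard (G : ℝ → H → H) (ε : ℝ → ℝ) (x₀ y : H) (x : ℝ → H) (t : ℝ) : H :=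
  (factor ε t)⁻¹ • (x₀ + ∫ s in (0 : ℝ)..t, integrand G ε y x s)

lemma factor_pos (ε : ℝ → ℝ) (t : ℝ) : 0 < factor ε t := Real.exp_pos _

lemma factor_zero (ε : ℝ → ℝ) : factor ε 0 = 1 := by simp [factor]

lemma hasDerivAt_factor (hε : Continuous ε) (t : ℝ) :
    HasDerivAt (factor ε) (factor ε t * (1 + ε t)) t :=
  hasDerivAt_exp_integral (continuous_const.add hε) 0 t

lemma contDiff_factor (hε : Continuous ε) : ContDiff ℝ 1 (factor ε) :=
  contDiff_exp_integral (continuous_const.add hε) 0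

lemma factor_mono (hε : Continuous ε) (hε0 : ∀ t, 0 ≤ ε t) : Monotone (factor ε) :=
  monotone_of_hasDerivAt_nonneg (hasDerivAt_factor hε) fun t =>
    mul_nonneg (factor_pos ε t).le (add_nonneg zero_le_one (hε0 t))

lemma integral_factor (hε : Continuous ε) (t : ℝ) :
    ∫ s in (0 : ℝ)..t, factor ε s * (1 + ε s) = factor ε t - 1 := by
  rw [intervalIntegral.integral_eq_sub_of_hasDerivAt (fun s _ => hasDerivAt_factor hε s)
    (((contDiff_factor hε).continuous.mul (continuous_const.add hε)).intervalIntegrable _ _),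
    factor_zero]

lemma intervalIntegrable_integrand (hG : NonexpansiveField D G) (hε : Continuous ε)
    (hx : ContinuousOn x (Ici 0)) (hxD : ∀ t, 0 ≤ t → x t ∈ D) {T : ℝ} (hT : 0 ≤ T) :
    IntervalIntegrable (integrand G ε y x) volume 0 T :=
  ((hG.intervalIntegrable_comp hx hxD hT).add
    ((hε.smul continuous_const).intervalIntegrable _ _)).continuousOn_smul
    (contDiff_factor hε).continuous.continuousOn

lemma locallyAC_picard (hG : NonexpansiveField D G) (hε : Continuous ε)
    (hx : ContinuousOn x (Ici 0)) (hxD : ∀ t, 0 ≤ t → x t ∈ D) :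
    LocallyAC (picard G ε x₀ y x) := by
  intro T hT
  have h1 : AbsolutelyContinuousOnInterval (fun t => (factor ε t)⁻¹) 0 T :=
    ((contDiff_factor hε).inv fun t =>
      (factor_pos ε t).ne').contDiffOn.absolutelyContinuousOnInterval
  have h2 : AbsolutelyContinuousOnInterval (fun _ : ℝ => x₀) 0 T :=
    contDiffOn_const.absolutelyContinuousOnInterval
  exact h1.fun_smul (h2.fun_add
    (hG.intervalIntegrable_integrand hε hx hxD hT.le).absolutelyContinuousOnInterval_integral)

lemma picard_zero : picard G ε x₀ y x 0 = x₀ := by simp [picard, factor_zero]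

lemma ae_hasDerivAt_picard [CompleteSpace H] (hG : NonexpansiveField D G) (hε : Continuous ε)
    (hx : ContinuousOn x (Ici 0)) (hxD : ∀ t, 0 ≤ t → x t ∈ D) :
    ∀ᵐ t, 0 < t → HasDerivAt (picard G ε x₀ y x)
      (G t (x t) + ε t • y - (1 + ε t) • picard G ε x₀ y x t) t := by
  have h := fun n : ℕ => (hG.intervalIntegrable_integrand (y := y) hε hx hxD
    (T := n) (by positivity)).ae_hasDerivAt_integral
  filter_upwards [ae_all_iff.mpr h] with t ht h0
  obtain ⟨n, hn⟩ := exists_nat_ge t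
  have h1 := ht n (by rw [uIcc_of_le (by positivity)]; exact ⟨h0.le, hn⟩) 0 left_mem_uIcc
  have hpos := (factor_pos ε t).ne'
  have h2 := ((hasDerivAt_factor hε t).fun_inv hpos).fun_smul (h1.const_add x₀)
  refine h2.congr_deriv ?_
  rw [integrand, inv_smul_smul₀ hpos, picard, smul_smul, sub_eq_add_neg, ← neg_smul]
  congr 2
  field_simp

/-- The formula averages x₀, with weight 1, and the points (G + εy)/(1 + ε) of D, with weight factor
· (1 + ε) ds; the total weight is `factor ε t`. A functional separating the average from D would
contradict this. -/
lemma picard_mem [CompleteSpace H] (hD : IsClosed D) (hDc : Convex ℝ D)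
    (hG : NonexpansiveField D G)
    (hε : Continuous ε) (hε0 : ∀ t, 0 ≤ ε t) (hx₀ : x₀ ∈ D) (hy : y ∈ D)
    (hx : ContinuousOn x (Ici 0)) (hxD : ∀ t, 0 ≤ t → x t ∈ D) {t : ℝ} (ht : 0 ≤ t) :
    picard G ε x₀ y x t ∈ D := by
  by_contra hmem
  obtain ⟨f, u, hfu, hub⟩ := geometric_hahn_banach_point_closed hDc hD hmem
  have hint := hG.intervalIntegrable_integrand (y := y) hε hx hxD ht
  have hpos := factor_pos ε t
  have hle : ∫ s in (0 : ℝ)..t, factor ε s * (1 + ε s) * u ≤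
      ∫ s in (0 : ℝ)..t, f (integrand G ε y x s) := by
    refine intervalIntegral.integral_mono_on_of_le_Ioo ht ?_
      ((intervalIntegrable_iff_integrableOn_Ioc_of_le ht).mpr (f.integrable_comp hint.1)) fun s hs => ?_
    · exact Continuous.intervalIntegrable (((contDiff_factor hε).continuous.mul
        (continuous_const.add hε)).mul continuous_const) _ _
    · have h1 := (hub _ (hG.mapsTo s hs.1 _ (hxD s hs.1.le))).le
      have h2 := mul_le_mul_of_nonneg_left (hub _ hy).le (hε0 s)
      rw [integrand, map_smul, map_add, map_smul, smul_eq_mul, smul_eq_mul, mul_assoc]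
      exact mul_le_mul_of_nonneg_left (by linarith) (factor_pos ε s).le
  rw [intervalIntegral.integral_mul_const, integral_factor hε,
    f.intervalIntegral_comp_comm hint] at hle
  rw [picard, map_smul, map_add, smul_eq_mul, inv_mul_lt_iff₀ hpos] at hfu
  linarith [hub _ hx₀]

/-- Enlarging the integrand by εC makes it an exact derivative, whence the constant 1 - 1/`factor ε
T`, which is below 1 on every bounded interval. -/
lemma norm_picard_sub_le (hG : NonexpansiveField D G)
    (hε : Continuous ε) (hε0 : ∀ t, 0 ≤ ε t) {x₁ x₂ : ℝ → H}
    (hx₁ : ContinuousOn x₁ (Ici 0)) (hx₁D : ∀ t, 0 ≤ t → x₁ t ∈ D)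
    (hx₂ : ContinuousOn x₂ (Ici 0)) (hx₂D : ∀ t, 0 ≤ t → x₂ t ∈ D) {T C : ℝ} (hC0 : 0 ≤ C)
    (hC : ∀ t ∈ Icc 0 T, ‖x₁ t - x₂ t‖ ≤ C) {t : ℝ} (ht : t ∈ Icc 0 T) :
    ‖picard G ε x₀ y x₁ t - picard G ε x₀ y x₂ t‖ ≤ (1 - (factor ε T)⁻¹) * C := by
  have hpos := factor_pos ε t
  have hle : ‖∫ s in (0 : ℝ)..t, (integrand G ε y x₁ s - integrand G ε y x₂ s)‖ ≤
      ∫ s in (0 : ℝ)..t, factor ε s * (1 + ε s) * C := by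
    refine intervalIntegral.norm_integral_le_of_norm_le ht.1 (Eventually.of_forall fun s hs => ?_)
      (Continuous.intervalIntegrable (((contDiff_factor hε).continuous.mul
        (continuous_const.add hε)).mul continuous_const) _ _)
    rw [integrand, integrand, ← smul_sub, add_sub_add_right_eq_sub, norm_smul,
      Real.norm_of_nonneg (factor_pos ε s).le, mul_assoc]
    refine mul_le_mul_of_nonneg_left ?_ (factor_pos ε s).le
    have h1 := hG.norm_sub_le s hs.1 _ (hx₁D s hs.1.le) _ (hx₂D s hs.1.le)
    have h2 := hC s ⟨hs.1.le, hs.2.trans ht.2⟩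
    have h3 := mul_nonneg (hε0 s) hC0
    linarith
  rw [intervalIntegral.integral_mul_const, integral_factor hε] at hle
  rw [picard, picard, ← smul_sub, add_sub_add_left_eq_sub, ← intervalIntegral.integral_sub
    (hG.intervalIntegrable_integrand hε hx₁ hx₁D ht.1)
    (hG.intervalIntegrable_integrand hε hx₂ hx₂D ht.1), norm_smul,
    Real.norm_of_nonneg (by positivity)]
  calc (factor ε t)⁻¹ * _ ≤ (factor ε t)⁻¹ * ((factor ε t - 1) * C) := by gcongr
    _ = (1 - (factor ε t)⁻¹) * C := by field_simp
    _ ≤ _ := by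
      gcongr
      exact factor_mono hε hε0 ht.2

/-- The variation of constants equation has a solution. -/
theorem exists_eqOn_picard [CompleteSpace H] (hD : IsClosed D) (hDc : Convex ℝ D)
    (hG : NonexpansiveField D G) (hε : Continuous ε) (hε0 : ∀ t, 0 ≤ ε t)
    (hx₀ : x₀ ∈ D) (hy : y ∈ D) :
    ∃ x : ℝ → H, ContinuousOn x (Ici 0) ∧ (∀ t, 0 ≤ t → x t ∈ D) ∧
      EqOn x (picard G ε x₀ y x) (Ici 0) := by
  set P := picard G ε x₀ y with hP
  set X : ℕ → ℝ → H := fun n => P^[n] fun _ => x₀ with hX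
  have hXsucc : ∀ n, X (n + 1) = P (X n) := fun n => Function.iterate_succ_apply' _ _ _
  have hXprop : ∀ n, ContinuousOn (X n) (Ici 0) ∧ ∀ t, 0 ≤ t → X n t ∈ D := by
    intro n
    induction n with
    | zero => exact ⟨continuousOn_const, fun _ _ => hx₀⟩
    | succ n ih =>
      rw [hXsucc]
      exact ⟨(hG.locallyAC_picard hε ih.1 ih.2).continuousOn,
        fun t ht => picard_mem hD hDc hG hε hε0 hx₀ hy ih.1 ih.2 ht⟩
  set k : ℝ → ℝ := fun T => 1 - (factor ε T)⁻¹ with hk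
  have hk1 : ∀ T, k T < 1 := fun T => sub_lt_self _ (inv_pos.mpr (factor_pos ε T))
  have hk0 : ∀ T, 0 ≤ T → 0 ≤ k T := fun T hT => by
    have := factor_mono hε hε0 hT
    rw [factor_zero] at this
    exact sub_nonneg.mpr (inv_le_one_of_one_le₀ this)
  -- The iterates live on all of [0, ∞); only the rate depends on T, so no local solutions need
  -- gluing.
  have hgeom : ∀ T, 0 ≤ T → ∃ C, 0 ≤ C ∧ ∀ n, ∀ t ∈ Icc 0 T,
      dist (X n t) (X (n + 1) t) ≤ C * k T ^ n := by
    intro T hT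
    obtain ⟨C, hC⟩ := isCompact_Icc.exists_bound_of_continuousOn
      (((hXprop 0).1.sub (hXprop 1).1).mono (Icc_subset_Ici_self (a := T)))
    have hC0 : 0 ≤ C := (norm_nonneg _).trans (hC 0 ⟨le_rfl, hT⟩)
    refine ⟨C, hC0, fun n => ?_⟩
    induction n with
    | zero =>
      intro t ht
      rw [pow_zero, mul_one, dist_eq_norm]
      exact hC t ht
    | succ n ih =>
      intro t ht
      have h := hG.norm_picard_sub_le (x₀ := x₀) (y := y) hε hε0 (hXprop n).1 (hXprop n).2
        (hXprop (n + 1)).1 (hXprop (n + 1)).2 (mul_nonneg hC0 (pow_nonneg (hk0 T hT) n))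
        (fun s hs => (dist_eq_norm (X n s) (X (n + 1) s)).symm.trans_le (ih s hs)) ht
      rw [dist_eq_norm, hXsucc (n + 1)]
      nth_rw 1 [hXsucc n]
      refine h.trans_eq ?_
      rw [pow_succ]
      ring
  have hlim : ∀ t, ∃ z, 0 ≤ t → Tendsto (fun n => X n t) atTop (𝓝 z) := by
    intro t
    by_cases ht : 0 ≤ t
    · obtain ⟨C, -, hC⟩ := hgeom t ht
      obtain ⟨z, hz⟩ := cauchySeq_tendsto_of_complete
        (cauchySeq_of_le_geometric (k t) C (hk1 t) fun n => hC n t ⟨ht, le_rfl⟩)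
      exact ⟨z, fun _ => hz⟩
    · exact ⟨0, fun h => absurd h ht⟩
  choose x hx using hlim
  have hrate : ∀ T, 0 ≤ T → ∃ C, 0 ≤ C ∧ ∀ n, ∀ t ∈ Icc 0 T, ‖X n t - x t‖ ≤ C * k T ^ n := by
    intro T hT
    obtain ⟨C, hC0, hC⟩ := hgeom T hT
    refine ⟨C / (1 - k T), div_nonneg hC0 (sub_nonneg.mpr (hk1 T).le), fun n t ht => ?_⟩
    rw [← dist_eq_norm, div_mul_eq_mul_div]
    exact dist_le_of_le_geometric_of_tendsto (k T) C (hk1 T) (fun n => hC n t ht) (hx t ht.1) n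
  have hxD : ∀ t, 0 ≤ t → x t ∈ D := fun t ht =>
    hD.mem_of_tendsto (hx t ht) (Eventually.of_forall fun n => (hXprop n).2 t ht)
  have hzero : ∀ T C, 0 ≤ T → Tendsto (fun n : ℕ => C * k T ^ n) atTop (𝓝 0) := fun T C hT => by
    simpa using (tendsto_pow_atTop_nhds_zero_of_lt_one (hk0 T hT) (hk1 T)).const_mul C
  have hxc : ContinuousOn x (Ici 0) := by
    refine continuousOn_Ici_of_Icc fun T hT => ?_
    obtain ⟨C, -, hC⟩ := hrate T hT.le
    refine TendstoUniformlyOn.continuousOn (F := X) (p := atTop) ?_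
      (Frequently.of_forall fun n => (hXprop n).1.mono Icc_subset_Ici_self)
    rw [Metric.tendstoUniformlyOn_iff]
    intro η hη
    filter_upwards [(hzero T C hT.le).eventually_lt_const hη] with n hn t ht
    rw [dist_comm, dist_eq_norm]
    exact (hC n t ht).trans_lt hn
  refine ⟨x, hxc, hxD, fun t ht => ?_⟩
  obtain ⟨C, hC0, hC⟩ := hrate t ht
  have h1 : Tendsto (fun n => X (n + 1) t) atTop (𝓝 (P x t)) := by
    rw [tendsto_iff_norm_sub_tendsto_zero]
    refine squeeze_zero (fun _ => norm_nonneg _) (fun n => ?_)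
      (by simpa using (hzero t C ht).const_mul (k t))
    rw [hXsucc]
    exact hG.norm_picard_sub_le hε hε0 (hXprop n).1 (hXprop n).2 hxc hxD
      (mul_nonneg hC0 (pow_nonneg (hk0 t ht) n)) (hC n) ⟨ht, le_rfl⟩
  exact tendsto_nhds_unique ((tendsto_add_atTop_iff_nat 1).mpr (hx t ht)) h1

end NonexpansiveField

/-- A Carathéodory-type existence theorem for the forward-backward system. -/
theorem exists_isTrajectory {H : Type*} [NormedAddCommGroup H] [InnerProductSpace ℝ H]
    [CompleteSpace H] {D : Set H} (hD : IsClosed D) (hDc : Convex ℝ D)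
    {Φt : ℝ → H → EReal} {Bt : ℝ → H → H} {μ : ℝ} {ε : ℝ → ℝ} {y x₀ : H}
    (hG : NonexpansiveField D fun t => forwardBackward μ (Φt t) (Bt t))
    (hε : ContinuousOn ε (Ici 0)) (hε0 : ∀ t, 0 ≤ t → 0 ≤ ε t) (hx₀ : x₀ ∈ D) (hy : y ∈ D) :
    ∃ x : ℝ → H, IsTrajectory D Φt Bt μ ε y x₀ x := by
  set ε' : ℝ → ℝ := fun t => ε (max t 0) with hε'
  have hε'c : Continuous ε' :=
    hε.comp_continuous (by fun_prop) fun t => mem_Ici.mpr (le_max_right _ _)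
  obtain ⟨x, hxc, hxD, hx⟩ := hG.exists_eqOn_picard hD hDc hε'c
    (fun t => hε0 _ (le_max_right _ _)) hx₀ hy
  refine ⟨x, fun T hT => ?_, hxD, (hx self_mem_Ici).trans NonexpansiveField.picard_zero, ?_⟩
  · refine (hG.locallyAC_picard (x₀ := x₀) (y := y) hε'c hxc hxD T hT).of_dist_le
      fun s hs t ht => ?_
    rw [uIcc_of_le hT.le] at hs ht
    rw [hx hs.1, hx ht.1]
  · rw [ae_restrict_iff' measurableSet_Ici]
    -- Time 0 is discarded: the fixed-point equation holds only on [0, ∞), which is no neighbourhood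
    -- of 0.
    filter_upwards [hG.ae_hasDerivAt_picard (x₀ := x₀) (y := y) hε'c hxc hxD,
      Measure.ae_ne volume 0] with t ht hne ht0
    have htpos : 0 < t := lt_of_le_of_ne ht0 hne.symm
    refine ((ht htpos).congr_of_eventuallyEq ?_).congr_deriv ?_
    · filter_upwards [lt_mem_nhds htpos] with s hs using hx hs.le
    · rw [← hx ht0]
      simp only [hε', max_eq_left htpos.le, forwardBackward]
      module

end Existence

theorem mainTheorem3 {H : Type*} [NormedAddCommGroup H] [InnerProductSpace ℝ H] [CompleteSpace H]
    (D : Set H) (hDclosed : IsClosed D) (hDconvex : Convex ℝ D)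
    -- the functions `Φ_t`, `t > 0`, and `Φ`
    (Φt : ℝ → H → EReal) (Φ : H → EReal)
    (hΦt : ∀ t : ℝ, 0 < t → ProperConvexLsc (Φt t)) (hΦ : ProperConvexLsc Φ)
    (hdomt : ∀ t : ℝ, 0 < t → closure (effDom (Φt t)) ⊆ D) (hdom : closure (effDom Φ) ⊆ D)
    -- the operators `B_t`, `t > 0`, and `B` on `D` (their values outside of `D` play no role)
    (β : ℝ) (Bt : ℝ → H → H) (B : H → H)
    (hBt : ∀ t : ℝ, 0 < t → CocoerciveOn β (Bt t) D) (hB : CocoerciveOn β B D)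
    (y : H) (hy : y ∈ D) (μ : ℝ) (hμ : μ ∈ Ioo 0 (2 * β))
    -- (i) the regularization parameter
    (ε : ℝ → ℝ) (hεpos : ∀ t : ℝ, 0 ≤ t → 0 < ε t) (hεac : LocallyAC ε)
    (hεanti : AntitoneOn ε (Ici 0)) (hεlim : Tendsto ε atTop (𝓝 0))
    (hεint : Tendsto (fun T : ℝ => ∫ s in (0 : ℝ)..T, ε s) atTop atTop)
    (hεderiv : Tendsto (fun t : ℝ => deriv ε t / ε t ^ 2) (atTop ⊓ ae volume) (𝓝 0))
    -- (ii) closeness of the proximal operators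
    (κ : ℝ → ℝ) (c p : ℝ) (hκ : ∀ t : ℝ, 0 < t → 0 ≤ κ t) (hc : 0 < c) (hp : 0 < p)
    (hprox : ∀ t : ℝ, 0 < t → ∀ z : H, ‖prox μ (Φt t) z - prox μ Φ z‖ ≤ κ t * (‖z‖ + c) ^ p)
    (hκε : Tendsto (fun t : ℝ => κ t / ε t) atTop (𝓝 0))
    -- (iii) closeness of the cocoercive operators on compact sets
    (hBK : ∀ K : Set H, IsCompact K → K ⊆ D →
      Tendsto (fun t : ℝ => 1 / ε t * ⨆ x : K, ‖Bt t x - B x‖) atTop (𝓝 0))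
    (x₀ : H) (hx₀ : x₀ ∈ D) :
    -- there is at most one solution
    (∀ x₁ x₂ : ℝ → H, IsTrajectory D Φt Bt μ ε y x₀ x₁ → IsTrajectory D Φt Bt μ ε y x₀ x₂ →
      EqOn x₁ x₂ (Ici 0)) ∧
    -- there is one, if the operators of the system are locally integrable in time
    ((∀ z ∈ D, LocallyIntegrableOn (fun t : ℝ => prox μ (Φt t) (z - μ • Bt t z)) (Ici 0)) →
      ∃ x : ℝ → H, IsTrajectory D Φt Bt μ ε y x₀ x) ∧
    -- the solution converges strongly to the projection of `y` onto the zeros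
    ((zerSum D Φ B).Nonempty →
      ∃ q : H, projSet (zerSum D Φ B) y = {q} ∧
        ∀ x : ℝ → H, IsTrajectory D Φt Bt μ ε y x₀ x → Tendsto x atTop (𝓝 q)) := by
  have hβ : 0 < β := by linarith [hμ.1, hμ.2]
  have hTt : ∀ t, 0 < t → ∀ u ∈ D, ∀ v ∈ D, ‖forwardBackward μ (Φt t) (Bt t) u -
      forwardBackward μ (Φt t) (Bt t) v‖ ≤ ‖u - v‖ := fun t ht u hu v hv =>
    norm_forwardBackward_sub_le (hΦt t ht) (hBt t ht) hμ hu hv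
  refine ⟨fun x₁ x₂ h₁ h₂ => h₁.eqOn hTt (fun t ht => (hεpos t ht).le) h₂, fun hint => ?_, ?_⟩
  · exact exists_isTrajectory hDclosed hDconvex
      ⟨fun t ht u _ => forwardBackward_mem (hΦt t ht) (hdomt t ht) hμ.1 u, hTt, hint⟩
      hεac.continuousOn (fun t ht => (hεpos t ht).le) hx₀ hy
  rintro ⟨z, hz⟩
  rw [zerSum_eq_fixedPoints hΦ hμ.1] at hz ⊢
  obtain ⟨w, q, R, hR, hw, hlip, hwq, hqD, hTq, hproj⟩ := exists_tikhonov_path hDclosed hDconvex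
    (fun u _ => forwardBackward_mem hΦ hdom hμ.1 u)
    (fun u hu v hv => norm_forwardBackward_sub_le hΦ hB hμ hu hv) hy hz.1 hz.2
  refine ⟨q, projSet_eq_singleton ⟨hqD, hTq⟩ fun p hp => hproj p hp.1 hp.2, fun x hx => ?_⟩
  -- The compact set for (iii): as ε is nonincreasing, it contains w(ε t) for all t ≥ 0.
  have hK := isCompact_range_tikhonov (b := ε 0) hlip hwq
  have hKD : Function.update w 0 q '' Icc 0 (ε 0) ⊆ D := by
    rintro _ ⟨e, he, rfl⟩
    rcases he.1.eq_or_lt with rfl | he0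
    · rwa [Function.update_self]
    · rw [Function.update_of_ne he0.ne']
      exact (hw e he0).1
  refine hx.tendsto_of_tikhonov_path hR hw hlip hwq hTt (fun η hη => ?_) hεpos hεac hεanti hεlim
    hεint hεderiv
  filter_upwards [eventually_norm_forwardBackward_sub_le hΦ hBt hB hβ hμ.1 hεpos hεlim hκ hc hp
    hprox hκε hK hKD (hBK _ hK hKD) hη, eventually_ge_atTop 0] with t ht ht0
  refine ht _ ⟨ε t, ⟨(hεpos t ht0).le, hεanti self_mem_Ici ht0 ht0⟩, ?_⟩
  rw [Function.update_of_ne (hεpos t ht0).ne']
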